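/- **Theorem 5.2 (Spectral Pseudo-Inverse, Fast and Explicit; SPIFE).** Let $n\ge 1$, $N=2^n$; all indices start at $0$. *The transform.* For $0\le m\le n$ let $E^n_m=\{(h,s)\in\mathbb Z\times\{0,\dots,N-1\}: -(s \bmod 2^m)\le h<N\}$. For $1\le m\le n$ the map $S^n_m:\mathbb R^{E^n_{m-1}}\to\mathbb R^{E^n_m}$, $f\mapsto g$, is $$g(h,\ell 2^m+2t+\varepsilon)=f(h,2\ell\,2^{m-1}+t)+f(h+t+\varepsilon,(2\ell+1)2^{m-1}+t),\qquad 0\le t<2^{m-1},\ \varepsilon\in\{0,1\},$$ with $f$ extended by zero. Let $T_{\rm I},\dots,T_{\rm IV}$ be the permutations $(T_{\rm I}f)(i,j)=f(j,N-1-i)$, $(T_{\rm II}f)(i,j)=f(N-1-i,j)$, $T_{\rm III}f=f$, $(T_{\rm IV}f)(i,j)=f(N-1-j,N-1-i)$ of $\mathbb R^{N\times N}$. Put $S^n_{(1)}=[S^n_1T_{\rm I};S^n_1T_{\rm II};S^n_1T_{\rm III};S^n_1T_{\rm IV}]$ (stacked), $S^n_{(m)}=I_4\otimes S^n_m$ for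 $2\le m\le n$. The full ADRT is $R^n=S^n_{(n)}\cdots S^n_{(1)}:\mathbb R^{N\times N}\to\mathbb R^{4\times E^n_n}$. *Levels $m\ge2$.* For $t\ge1$ let $\sigma_k=2\cos\frac{k\pi}{2t+2}$ ($1\le k\le t$), $\Sigma_t=\operatorname{diag}(\sigma_1,\dots,\sigma_t)$, and let $U_t\in\mathbb R^{(t+1)\times t}$, $V_t\in\mathbb R^{t\times t}$ have the columns $u_k(j)=\sqrt{\tfrac2{t+1}}\sin\frac{k\pi(j+1/2)}{t+1}$ and $v_k(j)=\sqrt{\tfrac2{t+1}}\sin\frac{k\pi(j+1)}{t+1}$. Let $H_s\in\mathbb R^{2s\times s}$ have ones at the entries $(2a,a)$, $(2a+1,a)$ and zeros elsewhere. For $0\le s<2^{m-1}$ put $$U_{[s]}=\operatorname{diag}[\tfrac1{\sqrt2}H_s,U_{2N},\tfrac1{\sqrt2}H_s],\quad \Sigma_{[s]}=\operatorname{diag}[\sqrt2 I_s,\Sigma_{2N},\sqrt2I_s],\quad V_{[s]}=\operatorname{diag}[I_s,V_{2N},I_s].$$ The permutation $P^n_m$ of $\mathbb R^{E^n_{m-1}}$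 lists, for each $\ell<2^{n-m}$ and $s<2^{m-1}$, the columns $u=f(\cdot,2\ell\,2^{m-1}+s)$ and $v=f(\cdot,(2\ell+1)2^{m-1}+s)$ as follows (each by increasing $h$): the first $s$ entries of $v$; then alternately an entry of $v$ and an entry of $u$, $N$ of each; then the last $s$ entries of $u$. The permutation $Q^n_m$ places, for each $(\ell,s)$, a list of length $2N+4s+1$ into the two columns $\ell2^m+2s$ and $\ell 2^m+2s+1$ of $E^n_m$, the cell $(h,\ell2^m+2s+\varepsilon)$ receiving the entry number $2h+\varepsilon+4s+1$. Then $U^n_{(m)}=I_4\otimes\big(Q^n_m(I_{2^{n-m}}\otimes\operatorname{blockdiag}_{s}U_{[s]})\big)$, $\Sigma^n_{(m)}=I_4\otimes I_{2^{n-m}}\otimes\operatorname{blockdiag}_s\Sigma_{[s]}$, $V^n_{(m)}=I_4\otimes\big((P^n_m)^\top(I_{2^{n-m}}\otimes\operatorname{blockdiag}_sV_{[s]})\big)$. *Level $1$.* Columns are indexed by $(p,k_1,k_2)$, $p\in\{0,1,2,3\}$, $1\le k_1,k_2\le N/2$. Let $\theta_k(x)=\frac{k\pi x}{N/2+1}$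 and, for integers $j_1,j_2$, $$\phi_{k_1,k_2}(j_1,j_2)=\tfrac4{N+2}\sin\theta_{k_1}(j_1+1)\,\sin\theta_{k_2}(j_2+1);$$ let $\psi^{+\circ}$, $\psi^{-\circ}$ be $\phi$ with the first factor replaced by $\sin\theta_{k_1}(j_1+\frac12)$, $\cos\theta_{k_1}(j_1+\frac12)$, and $\psi^{\circ+}$, $\psi^{\circ-}$ be $\phi$ with the second factor replaced by $\sin\theta_{k_2}(j_2+\frac12)$, $\cos\theta_{k_2}(j_2+\frac12)$. Let $\sigma_k^+=2\cos\frac{k\pi}{N+2}$, $\sigma^-_k=2\sin\frac{k\pi}{N+2}$. Let $\chi^{(p)}_{(j_1,j_2)}\in\mathbb R^{N\times N}$ be zero outside of the block $\{2j_1,2j_1+1\}\times\{2j_2,2j_2+1\}$, on which it is $\begin{bmatrix}1&0\\0&1\end{bmatrix}$, $\begin{bmatrix}-1&0\\0&1\end{bmatrix}$, $\begin{bmatrix}0&1\\1&0\end{bmatrix}$, $\begin{bmatrix}0&-1\\1&0\end{bmatrix}$ for $p=0,1,2,3$. The columns of $V^n_{(1)}$ are $v^{(p)}_{k_1,k_2}=\frac1{\sqrt2}\sum_{0\le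 j_1,j_2<N/2}\phi_{k_1,k_2}(j_1,j_2)\chi^{(p)}_{(j_1,j_2)}$. The diagonal matrix $\Sigma^n_{(1)}$ has the entries $\sigma^{(p)}_{k_1,k_2}=\big(8+\frac12(\sigma^+_{k_1})^2+\frac12(\sigma^+_{k_2})^2\big)^{1/2}$ for $p=0,2$ and $\big(4+\frac12(\sigma^-_{k_1})^2+\frac12(\sigma^-_{k_2})^2\big)^{1/2}$ for $p=1,3$. The columns of $U^n_{(1)}$ are $w^{(p)}_{k_1,k_2}/\sigma^{(p)}_{k_1,k_2}$. To describe $w^{(p)}_{k_1,k_2}$ at the entry $(h,s)\in E^n_1$ of a quadrant, let $(i_1,i_2)$ be the pixel $(s,N-1-h)$, $(N-1-h,s)$, $(h,s)$, $(N-1-s,N-1-h)$ for quadrants I, II, III, IV, and let $\phi$ stand for $\phi_{k_1,k_2}(\lfloor i_1/2\rfloor,\lfloor i_2/2\rfloor)$, $\psi^{\pm\circ}$ for $\psi^{\pm\circ}_{k_1,k_2}(\lceil i_1/2\rceil,\lfloor i_2/2\rfloor)$, and $\psi^{\circ\pm}$ for $\psi^{\circ\pm}_{k_1,k_2}(\lfloor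 i_1/2\rfloor,\lceil i_2/2\rceil)$. The values of $\sqrt2\,w^{(p)}_{k_1,k_2}$, in the order ($h$ even, $s$ even), ($h$ odd, $s$ even), ($h$ even, $s$ odd), ($h$ odd, $s$ odd), are | | I | II | III | IV | |---|---|---|---|---| | $p=0$ | $\phi,\phi,0,\sigma^+_{k_2}\psi^{\circ+}$ | $\phi,\phi,0,\sigma^+_{k_1}\psi^{+\circ}$ | $\phi,\phi,2\phi,0$ | $\phi,\phi,2\phi,0$ | | $p=1$ | $\phi,-\phi,0,-\sigma^-_{k_2}\psi^{\circ-}$ | $\phi,-\phi,0,-\sigma^-_{k_1}\psi^{-\circ}$ | $-\phi,\phi,0,0$ | $\phi,-\phi,0,0$ | | $p=2$ | $\phi,\phi,2\phi,0$ | $\phi,\phi,2\phi,0$ | $\phi,\phi,0,\sigma^+_{k_1}\psi^{+\circ}$ | $\phi,\phi,0,\sigma^+_{k_2}\psi^{\circ+}$ | | $p=3$ | $-\phi,\phi,0,0$ | $\phi,-\phi,0,0$ | $-\phi,\phi,0,-\sigma^-_{k_1}\psi^{-\circ}$ | $-\phi,\phi,0,\sigma^-_{k_2}\psi^{\circ-}$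 | Let $M$ be the diagonal $0$-$1$ matrix which deletes the entries with $h$ and $s$ both odd. Let $Q$ be the orthogonal matrix which replaces the columns of types $0$ and $2$ by $\frac1{\sqrt2}$ times their sum (type $0$) and their difference (type $2$) and leaves the types $1$ and $3$ unchanged. Let $D$ be the diagonal matrix with the entries $2\sqrt3$ for $p=0$ and $2$ for $p=1,2,3$ (the lengths of the columns of $MU^n_{(1)}\Sigma^n_{(1)}Q$). Put $$\widehat U^n_{(1)}=MU^n_{(1)}\Sigma^n_{(1)}QD^{-1},\qquad \widehat V^n_{(1)}=V^n_{(1)}QD^{-1}.$$ *Claim.* For every $n\ge1$ the matrix $$(R^n)^\dagger:=\widehat V^n_{(1)}\,\widehat U^{n\top}_{(1)}\prod_{m=2}^nV^n_{(m)}(\Sigma^n_{(m)})^{-1}U^{n\top}_{(m)}$$ (factors in the order of increasing $m$ from left to right) is a pseudo-inverse of $R^n$ that is exact on data in the range: $(R^n)^\dagger R^n=I$, $R^n(R^n)^\dagger R^n=R^n$, $(R^n)^\dagger R^n(R^n)^\dagger=(R^n)^\dagger$, and for every $b$ in the range of $R^n$ the image $x=(R^n)^\dagger b$ is the unique solution of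 $R^nx=b$. Moreover the product $(R^n)^\dagger b$ can be computed, for arbitrary $b\in\mathbb R^{4\times E^n_n}$, in $O(N^2\log^2N)$ arithmetic operations: there is a constant $C$ such that for every $n\ge1$ there is a straight-line program of at most $C N^2(\log N)^2$ additions, subtractions, multiplications and loadings of real constants which computes $(R^n)^\dagger b$ from $b$. -/

import Mathlib

open scoped Matrix Kronecker

noncomputable section

namespace ADRT

/-! ### Images, data index sets and the transform

Throughout `N = 2 ^ n`, indices start at `0`, and the four quadrants I, II, III, IV are numbered
`0, 1, 2, 3`. -/

/-- The index set of an `N × N` image. -/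
abbrev Img (n : ℕ) : Type := Fin (2 ^ n) × Fin (2 ^ n)

/-- The index set `E^n_m` of all `(h, s)` with `0 ≤ s < 2^n` and `-(s mod 2^m) ≤ h < 2^n`. -/
def E (n m : ℕ) : Finset (ℤ × ℕ) :=
  (Finset.Ico (-(2 : ℤ) ^ n) (2 ^ n) ×ˢ Finset.range (2 ^ n)).filter
    (fun e => -((e.2 % 2 ^ m : ℕ) : ℤ) ≤ e.1)

/-- The single-quadrant level `m = j + 1`, a map from data on `E^n_j` to data on `E^n_{j+1}`:
in the output column `ℓ 2^(j+1) + 2 t + ε` with `t < 2^j`, `ε ∈ {0, 1}`,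
`g (h, ℓ 2^(j+1) + 2 t + ε) = f (h, 2ℓ 2^j + t) + f (h + t + ε, (2ℓ + 1) 2^j + t)`,
where `f` is extended by zero outside of its index set. -/
def level (n j : ℕ) : Matrix (E n (j + 1)) (E n j) ℝ :=
  Matrix.of fun g f =>
    let h : ℤ := g.1.1
    let l : ℕ := g.1.2 / 2 ^ (j + 1)
    let t : ℕ := (g.1.2 % 2 ^ (j + 1)) / 2
    let ε : ℕ := g.1.2 % 2
    (if f.1 = (h, 2 * l * 2 ^ j + t) then 1 else 0)
      + (if f.1 = (h + t + ε, (2 * l + 1) * 2 ^ j + t) then 1 else 0)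

/-- The pixel `(i₁, i₂)` read by the quadrant permutation `T_q` at position `(h, s)`, that is
`(T_q f)(h, s) = f (i₁, i₂)`. -/
def source (n : ℕ) (q : Fin 4) (h s : ℤ) : ℤ × ℤ :=
  match q with
  | 0 => (s, 2 ^ n - 1 - h)
  | 1 => (2 ^ n - 1 - h, s)
  | 2 => (h, s)
  | 3 => (2 ^ n - 1 - s, 2 ^ n - 1 - h)

/-- The quadrant permutation `T_q`; note that `E^n_0` is the set of all pixels `(h, s)`. -/
def quadrant (n : ℕ) (q : Fin 4) : Matrix (E n 0) (Img n) ℝ :=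
  Matrix.of fun e i => if ((i.1 : ℤ), (i.2 : ℤ)) = source n q e.1.1 e.1.2 then 1 else 0

/-- The cross-quadrant level `S^n_(1)`: the four matrices `S^n_1 T_q` stacked. -/
def crossLevel (n : ℕ) : Matrix (Fin 4 × E n 1) (Img n) ℝ :=
  Matrix.of fun r i => (level n 0 * quadrant n r.1) r.2 i

/-- The full level `S^n_(m) = I₄ ⊗ S^n_m` for `m = j + 1 ≥ 2`. -/
def fullLevel (n j : ℕ) : Matrix (Fin 4 × E n (j + 1)) (Fin 4 × E n j) ℝ :=
  (1 : Matrix (Fin 4) (Fin 4) ℝ) ⊗ₖ level n j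

/-- The product `S^n_(m) ⋯ S^n_(1)` for `m ≥ 1` (the value at `m = 0` is not used). The full
transform `R^n` is the case `m = n`. -/
def transform (n : ℕ) : (m : ℕ) → Matrix (Fin 4 × E n m) (Img n) ℝ
  | 0 => 0
  | 1 => crossLevel n
  | m + 2 => fullLevel n (m + 1) * transform n (m + 1)

/-! ### Singular value decomposition of the levels `m ≥ 2` -/

/-- Left singular vectors of the `(t+1) × t` convolution matrix with kernel `[1, 1]`. -/
def convU (t : ℕ) : Matrix (Fin (t + 1)) (Fin t) ℝ :=
  Matrix.of fun i k => √(2 / ((t : ℝ) + 1)) *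
    Real.sin (((k : ℝ) + 1) * Real.pi * ((i : ℝ) + 1 / 2) / ((t : ℝ) + 1))

/-- Right singular vectors of the same convolution matrix. -/
def convV (t : ℕ) : Matrix (Fin t) (Fin t) ℝ :=
  Matrix.of fun i k => √(2 / ((t : ℝ) + 1)) *
    Real.sin (((k : ℝ) + 1) * Real.pi * ((i : ℝ) + 1) / ((t : ℝ) + 1))

/-- Singular values of the same convolution matrix. -/
def convSigma (t : ℕ) (k : Fin t) : ℝ :=
  2 * Real.cos (((k : ℝ) + 1) * Real.pi / (2 * (t : ℝ) + 2))

/-- The `2s × s` matrix `H_s` each of whose columns has two consecutive ones, divided by `√2`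
so that its columns are orthonormal. -/
def doubling (s : ℕ) : Matrix (Fin s × Fin 2) (Fin s) ℝ :=
  Matrix.of fun a b => if a.1 = b then 1 / √2 else 0

/-- Column indices of the block matrix `diag [H_s, K_{2N}, H_s]`. -/
abbrev BlockCol (n s : ℕ) : Type := Fin s ⊕ (Fin (2 * 2 ^ n) ⊕ Fin s)

/-- Row indices of the block matrix `diag [H_s, K_{2N}, H_s]`. -/
abbrev BlockRow (n s : ℕ) : Type :=
  (Fin s × Fin 2) ⊕ (Fin (2 * 2 ^ n + 1) ⊕ (Fin s × Fin 2))

/-- Left singular vectors of `diag [H_s, K_{2N}, H_s]`. -/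
def blockU (n s : ℕ) : Matrix (BlockRow n s) (BlockCol n s) ℝ :=
  Matrix.fromBlocks (doubling s) 0 0
    (Matrix.fromBlocks (convU (2 * 2 ^ n)) 0 0 (doubling s))

/-- Right singular vectors of `diag [H_s, K_{2N}, H_s]`. -/
def blockV (n s : ℕ) : Matrix (BlockCol n s) (BlockCol n s) ℝ :=
  Matrix.fromBlocks 1 0 0 (Matrix.fromBlocks (convV (2 * 2 ^ n)) 0 0 1)

/-- Singular values of `diag [H_s, K_{2N}, H_s]`. -/
def blockSigma (n s : ℕ) : Matrix (BlockCol n s) (BlockCol n s) ℝ :=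
  Matrix.diagonal
    (Sum.elim (fun _ => √2) (Sum.elim (convSigma (2 * 2 ^ n)) (fun _ => √2)))

/-- Flattened column indices for the level `m = j + 1`: a section number `ℓ`, a column number
`s < 2^j` inside of the half sections, and a position in the block. -/
abbrev FlatCol (n j : ℕ) : Type :=
  Fin (2 ^ (n - (j + 1))) × (Σ s : Fin (2 ^ j), BlockCol n s)

/-- Flattened row indices for the level `m = j + 1`. -/
abbrev FlatRow (n j : ℕ) : Type :=
  Fin (2 ^ (n - (j + 1))) × (Σ s : Fin (2 ^ j), BlockRow n s)

/-- Alternating concatenation with shift `s`: the cell of `E^n_j` listed at a position of the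
block `(ℓ, s)`. With `u`, `v` the columns `(2ℓ) 2^j + s` and `(2ℓ + 1) 2^j + s`, the list starts
with the first `s` entries of `v`, then alternates between `v` and `u` (`N` entries each), and
ends with the last `s` entries of `u`. -/
def colCell (n j l s : ℕ) : BlockCol n s → ℤ × ℕ
  | Sum.inl a => ((a : ℤ) - s, (2 * l + 1) * 2 ^ j + s)
  | Sum.inr (Sum.inl c) =>
      if (c : ℕ) % 2 = 0 then (((c : ℕ) / 2 : ℕ), (2 * l + 1) * 2 ^ j + s)
      else ((((c : ℕ) / 2 : ℕ) : ℤ) - s, 2 * l * 2 ^ j + s)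
  | Sum.inr (Sum.inr a) => ((2 : ℤ) ^ n - s + a, 2 * l * 2 ^ j + s)

/-- Position of a row in its block, counted so that the middle part is `0, …, 2N`. -/
def rowPos (n s : ℕ) : BlockRow n s → ℤ
  | Sum.inl a => 2 * (a.1 : ℤ) + ((a.2 : ℕ) : ℤ) - 2 * s
  | Sum.inr (Sum.inl i) => ((i : ℕ) : ℤ)
  | Sum.inr (Sum.inr a) => 2 * 2 ^ n + 1 + 2 * (a.1 : ℤ) + ((a.2 : ℕ) : ℤ)

/-- The cell of `E^n_{j+1}` listed at a position of the block `(ℓ, s)`: the output columns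
`ℓ 2^(j+1) + 2s` and `ℓ 2^(j+1) + 2s + 1` are listed alternately. The position of the cell
`(h, ℓ 2^(j+1) + 2s + ε)` is `2h + ε + 2s + 1`; the division below rounds down. -/
def rowCell (n j l s : ℕ) (y : BlockRow n s) : ℤ × ℕ :=
  ((rowPos n s y - (2 * s + 1)) / 2,
    l * 2 ^ (j + 1) + 2 * s + ((rowPos n s y - (2 * s + 1)) % 2).toNat)

/-- The flattening permutation `P^n_m`, `m = j + 1`. -/
def flatten (n j : ℕ) : Matrix (FlatCol n j) (E n j) ℝ :=
  Matrix.of fun x e => if e.1 = colCell n j x.1 x.2.1 x.2.2 then 1 else 0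

/-- The unflattening permutation `Q^n_m`, `m = j + 1`. -/
def unflatten (n j : ℕ) : Matrix (E n (j + 1)) (FlatRow n j) ℝ :=
  Matrix.of fun e y => if e.1 = rowCell n j y.1 y.2.1 y.2.2 then 1 else 0

/-- `U^n_(m) = I₄ ⊗ (Q^n_m U^n_m)`, where `m = j + 1` and `U^n_m = I ⊗ blockdiag [U_{·,s}]`. -/
def levelU (n j : ℕ) : Matrix (Fin 4 × E n (j + 1)) (Fin 4 × FlatCol n j) ℝ :=
  (1 : Matrix (Fin 4) (Fin 4) ℝ) ⊗ₖ
    (unflatten n j * ((1 : Matrix (Fin (2 ^ (n - (j + 1)))) (Fin (2 ^ (n - (j + 1)))) ℝ) ⊗ₖ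
      Matrix.blockDiagonal' (fun s : Fin (2 ^ j) => blockU n s)))

/-- `Σ^n_(m) = I₄ ⊗ Σ^n_m`, where `m = j + 1`. -/
def levelSigma (n j : ℕ) : Matrix (Fin 4 × FlatCol n j) (Fin 4 × FlatCol n j) ℝ :=
  (1 : Matrix (Fin 4) (Fin 4) ℝ) ⊗ₖ
    ((1 : Matrix (Fin (2 ^ (n - (j + 1)))) (Fin (2 ^ (n - (j + 1)))) ℝ) ⊗ₖ
      Matrix.blockDiagonal' (fun s : Fin (2 ^ j) => blockSigma n s))

/-- `V^n_(m) = I₄ ⊗ ((P^n_m)ᵀ V^n_m)`, where `m = j + 1`. -/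
def levelV (n j : ℕ) : Matrix (Fin 4 × E n j) (Fin 4 × FlatCol n j) ℝ :=
  (1 : Matrix (Fin 4) (Fin 4) ℝ) ⊗ₖ
    ((flatten n j)ᵀ * ((1 : Matrix (Fin (2 ^ (n - (j + 1)))) (Fin (2 ^ (n - (j + 1)))) ℝ) ⊗ₖ
      Matrix.blockDiagonal' (fun s : Fin (2 ^ j) => blockV n s)))

/-! ### Spectral decomposition of the cross-quadrant level and its explicit inverse -/

/-- Indices `(p, k₁, k₂)` of the spectral decomposition; the entry `k` of `Fin (N/2)` stands for
the frequency `k + 1 ∈ {1, …, N/2}`. -/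
abbrev Spec (n : ℕ) : Type := Fin 4 × Fin (2 ^ (n - 1)) × Fin (2 ^ (n - 1))

/-- The angle `k π x / (N/2 + 1)` for the frequency `k + 1` in place of `k`. -/
def angle (n k : ℕ) (x : ℝ) : ℝ :=
  ((k : ℝ) + 1) * Real.pi * x / ((2 : ℝ) ^ n / 2 + 1)

/-- The sinusoid `φ_{(k₁,k₂)}`, normalised in `ℓ²`. -/
def phi (n k₁ k₂ : ℕ) (j₁ j₂ : ℤ) : ℝ :=
  4 / ((2 : ℝ) ^ n + 2) *
    Real.sin (angle n k₁ ((j₁ : ℝ) + 1)) * Real.sin (angle n k₂ ((j₂ : ℝ) + 1))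

/-- The variant `ψ^{+∘}_{(k₁,k₂)}`. -/
def psiPlusFst (n k₁ k₂ : ℕ) (j₁ j₂ : ℤ) : ℝ :=
  4 / ((2 : ℝ) ^ n + 2) *
    Real.sin (angle n k₁ ((j₁ : ℝ) + 1 / 2)) * Real.sin (angle n k₂ ((j₂ : ℝ) + 1))

/-- The variant `ψ^{∘+}_{(k₁,k₂)}`. -/
def psiPlusSnd (n k₁ k₂ : ℕ) (j₁ j₂ : ℤ) : ℝ :=
  4 / ((2 : ℝ) ^ n + 2) *
    Real.sin (angle n k₁ ((j₁ : ℝ) + 1)) * Real.sin (angle n k₂ ((j₂ : ℝ) + 1 / 2))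

/-- The variant `ψ^{-∘}_{(k₁,k₂)}`. -/
def psiMinusFst (n k₁ k₂ : ℕ) (j₁ j₂ : ℤ) : ℝ :=
  4 / ((2 : ℝ) ^ n + 2) *
    Real.cos (angle n k₁ ((j₁ : ℝ) + 1 / 2)) * Real.sin (angle n k₂ ((j₂ : ℝ) + 1))

/-- The variant `ψ^{∘-}_{(k₁,k₂)}`. -/
def psiMinusSnd (n k₁ k₂ : ℕ) (j₁ j₂ : ℤ) : ℝ :=
  4 / ((2 : ℝ) ^ n + 2) *
    Real.sin (angle n k₁ ((j₁ : ℝ) + 1)) * Real.cos (angle n k₂ ((j₂ : ℝ) + 1 / 2))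

/-- `σ⁺_k = 2 cos (k π / (N + 2))`, for the frequency `k + 1` in place of `k`. -/
def sigmaPlus (n k : ℕ) : ℝ := 2 * Real.cos (((k : ℝ) + 1) * Real.pi / ((2 : ℝ) ^ n + 2))

/-- `σ⁻_k = 2 sin (k π / (N + 2))`, for the frequency `k + 1` in place of `k`. -/
def sigmaMinus (n k : ℕ) : ℝ := 2 * Real.sin (((k : ℝ) + 1) * Real.pi / ((2 : ℝ) ^ n + 2))

/-- The four `2 × 2` patterns of the functions `χ^{(p)}`. -/
def pattern : Fin 4 → Matrix (Fin 2) (Fin 2) ℝ :=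
  ![!![1, 0; 0, 1], !![-1, 0; 0, 1], !![0, 1; 1, 0], !![0, -1; 1, 0]]

/-- The function `χ^{(p)}_{(j₁,j₂)}`: the pattern `p` placed on the `2 × 2` block `(j₁, j₂)`. -/
def chi (n : ℕ) (p : Fin 4) (j₁ j₂ : ℕ) (i : Img n) : ℝ :=
  if (i.1 : ℕ) / 2 = j₁ ∧ (i.2 : ℕ) / 2 = j₂ then
    pattern p (Fin.ofNat 2 (i.1 : ℕ)) (Fin.ofNat 2 (i.2 : ℕ))
  else 0

/-- `V^n_(1)`, with columns `v^{(p)}_{(k₁,k₂)} = 2^{-1/2} ∑_j φ_{(k₁,k₂)}(j) χ^{(p)}_j`. -/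
def crossV (n : ℕ) : Matrix (Img n) (Spec n) ℝ :=
  Matrix.of fun i c => 1 / √2 *
    ∑ j₁ : Fin (2 ^ (n - 1)), ∑ j₂ : Fin (2 ^ (n - 1)),
      phi n c.2.1 c.2.2 (j₁ : ℕ) (j₂ : ℕ) * chi n c.1 j₁ j₂ i

/-- The diagonal values of `Σ^n_(1)`. -/
def crossSigmaVal (n : ℕ) (c : Spec n) : ℝ :=
  if c.1 = 0 ∨ c.1 = 2 then
    √(8 + 1 / 2 * sigmaPlus n c.2.1 ^ 2 + 1 / 2 * sigmaPlus n c.2.2 ^ 2)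
  else
    √(4 + 1 / 2 * sigmaMinus n c.2.1 ^ 2 + 1 / 2 * sigmaMinus n c.2.2 ^ 2)

/-- `Σ^n_(1)`. -/
def crossSigma (n : ℕ) : Matrix (Spec n) (Spec n) ℝ := Matrix.diagonal (crossSigmaVal n)

/-- Coefficients (type `p`, quadrant `q`) of `φ` at the entries with `h` even, `s` even. -/
def coeffEvenEven : Matrix (Fin 4) (Fin 4) ℝ :=
  !![1, 1, 1, 1; 1, 1, -1, 1; 1, 1, 1, 1; -1, 1, -1, -1]

/-- Coefficients (type `p`, quadrant `q`) of `φ` at the entries with `h` odd, `s` even. -/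
def coeffOddEven : Matrix (Fin 4) (Fin 4) ℝ :=
  !![1, 1, 1, 1; -1, -1, 1, -1; 1, 1, 1, 1; 1, -1, 1, 1]

/-- Coefficients (type `p`, quadrant `q`) of `φ` at the entries with `h` even, `s` odd. -/
def coeffEvenOdd : Matrix (Fin 4) (Fin 4) ℝ :=
  !![0, 0, 2, 2; 0, 0, 0, 0; 2, 2, 0, 0; 0, 0, 0, 0]

/-- The entries with `h` odd, `s` odd, where two neighbouring `2 × 2` blocks interact. Here
`(j₁, j₂)` is the block of the pixel `(i₁, i₂)` belonging to `(h, s)` in the image; along the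
direction in which `h` runs the index is that of the interface between the blocks. -/
def crossTerm (n : ℕ) (p q : Fin 4) (k₁ k₂ : ℕ) (i₁ i₂ : ℤ) : ℝ :=
  match p, q with
  | 0, 0 => sigmaPlus n k₂ * psiPlusSnd n k₁ k₂ (i₁ / 2) ((i₂ + 1) / 2)
  | 0, 1 => sigmaPlus n k₁ * psiPlusFst n k₁ k₂ ((i₁ + 1) / 2) (i₂ / 2)
  | 1, 0 => -(sigmaMinus n k₂ * psiMinusSnd n k₁ k₂ (i₁ / 2) ((i₂ + 1) / 2))
  | 1, 1 => -(sigmaMinus n k₁ * psiMinusFst n k₁ k₂ ((i₁ + 1) / 2) (i₂ / 2))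
  | 2, 2 => sigmaPlus n k₁ * psiPlusFst n k₁ k₂ ((i₁ + 1) / 2) (i₂ / 2)
  | 2, 3 => sigmaPlus n k₂ * psiPlusSnd n k₁ k₂ (i₁ / 2) ((i₂ + 1) / 2)
  | 3, 2 => -(sigmaMinus n k₁ * psiMinusFst n k₁ k₂ ((i₁ + 1) / 2) (i₂ / 2))
  | 3, 3 => sigmaMinus n k₂ * psiMinusSnd n k₁ k₂ (i₁ / 2) ((i₂ + 1) / 2)
  | _, _ => 0

/-- The entry at `(h, s)` of quadrant `q` of the vector `w^{(p)}_{(k₁,k₂)}` (put back in the order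
of `E^n_1`), which is the image of `v^{(p)}_{(k₁,k₂)}`. -/
def crossW (n : ℕ) (c : Spec n) (q : Fin 4) (h s : ℤ) : ℝ :=
  let i := source n q h s
  let f := phi n c.2.1 c.2.2 (i.1 / 2) (i.2 / 2)
  1 / √2 *
    (if s % 2 = 0 then
      (if h % 2 = 0 then coeffEvenEven c.1 q * f else coeffOddEven c.1 q * f)
    else
      (if h % 2 = 0 then coeffEvenOdd c.1 q * f else crossTerm n c.1 q c.2.1 c.2.2 i.1 i.2))

/-- `U^n_(1)`: the vectors `w^{(p)}_{(k₁,k₂)}`, scaled to unit length. -/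
def crossU (n : ℕ) : Matrix (Fin 4 × E n 1) (Spec n) ℝ :=
  Matrix.of fun r c => crossW n c r.1 r.2.1.1 (r.2.1.2 : ℕ) / crossSigmaVal n c

/-- The truncation `M^n_(1)`: it deletes the entries with `h` and `s` odd. -/
def trunc (n : ℕ) : Matrix (Fin 4 × E n 1) (Fin 4 × E n 1) ℝ :=
  Matrix.diagonal fun r => if r.2.1.1 % 2 = 1 ∧ r.2.1.2 % 2 = 1 then 0 else 1

/-- The orthogonal matrix `Q^n_(1)`, which replaces the types `0`, `2` by their normalised sum
and difference. -/
def mix (n : ℕ) : Matrix (Spec n) (Spec n) ℝ :=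
  !![1 / √2, 0, 1 / √2, 0;
     0, 1, 0, 0;
     1 / √2, 0, -(1 / √2), 0;
     0, 0, 0, 1] ⊗ₖ
    (1 : Matrix (Fin (2 ^ (n - 1)) × Fin (2 ^ (n - 1)))
      (Fin (2 ^ (n - 1)) × Fin (2 ^ (n - 1))) ℝ)

/-- The diagonal matrix `D` of the lengths of the columns of `M U Σ Q`. -/
def scale (n : ℕ) : Matrix (Spec n) (Spec n) ℝ :=
  Matrix.diagonal fun c => if c.1 = 0 then 2 * √3 else 2

/-- `Û^n_(1) = M U Σ Q D⁻¹`, the normalised columns of `M U Σ Q`. -/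
def crossUHat (n : ℕ) : Matrix (Fin 4 × E n 1) (Spec n) ℝ :=
  trunc n * crossU n * crossSigma n * mix n * (scale n)⁻¹

/-- `V̂^n_(1) = V Q D⁻¹`. -/
def crossVHat (n : ℕ) : Matrix (Img n) (Spec n) ℝ :=
  crossV n * mix n * (scale n)⁻¹

/-- The product `V̂_(1) Û_(1)ᵀ ∏_{i=2}^m V_(i) Σ_(i)⁻¹ U_(i)ᵀ` for `m ≥ 1` (the value at `m = 0`
is not used). The pseudo-inverse of `R^n` is the case `m = n`. -/
def spife (n : ℕ) : (m : ℕ) → Matrix (Img n) (Fin 4 × E n m) ℝ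
  | 0 => 0
  | 1 => crossVHat n * (crossUHat n)ᵀ
  | m + 2 => spife n (m + 1) *
      (levelV n (m + 1) * (levelSigma n (m + 1))⁻¹ * (levelU n (m + 1))ᵀ)

/-! ### Counting arithmetic operations -/

/-- One operation of a straight-line program with inputs indexed by `ι`. An operand is an input
or (by its number, from `0`) the result of an earlier operation. -/
inductive Op (ι : Type) : Type
  | const (c : ℝ) : Op ι
  | add (a b : ι ⊕ ℕ) : Op ι
  | sub (a b : ι ⊕ ℕ) : Op ι
  | mul (a b : ι ⊕ ℕ) : Op ι

/-- The value of an operand, given the inputs and the list of the results so far. -/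
def operand {ι : Type} (x : ι → ℝ) (mem : List ℝ) : ι ⊕ ℕ → ℝ
  | Sum.inl i => x i
  | Sum.inr r => mem.getD r 0

/-- The result of one operation. -/
def Op.eval {ι : Type} (x : ι → ℝ) (mem : List ℝ) : Op ι → ℝ
  | Op.const c => c
  | Op.add a b => operand x mem a + operand x mem b
  | Op.sub a b => operand x mem a - operand x mem b
  | Op.mul a b => operand x mem a * operand x mem b

/-- The list of the results of all operations, in order of execution. -/
def run {ι : Type} (x : ι → ℝ) (code : List (Op ι)) : List ℝ :=
  code.foldl (fun mem o => mem ++ [o.eval x mem]) []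

/-- `F` can be evaluated at every input by one and the same straight-line program, with at most
`T` arithmetic operations in real numbers (loading a constant counts as one operation). -/
def ComputableIn {ι κ : Type} (F : (ι → ℝ) → κ → ℝ) (T : ℝ) : Prop :=
  ∃ (code : List (Op ι)) (out : κ → ι ⊕ ℕ), (code.length : ℝ) ≤ T ∧
    ∀ x k, operand x (run x code) (out k) = F x k

end ADRT

end

/-!
The identity `R† R = 1` implies the other algebraic claims, so it is enough that the factors of `R†`
are left inverses of the corresponding factors of `R`.

For a level `m ≥ 2`, listing the cells by `flatten` and `unflatten` turns the level into a block
diagonal matrix with blocks `diag [H_s, K, H_s]` (`unflatten_level_flatten`), where `K` is the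
convolution matrix with kernel `[1, 1]`. The addition theorem for the sine gives `Uᵀ K = Σ Vᵀ`, and
`V Vᵀ = 1` is the orthogonality of the discrete sine transform (`convV_mul_transpose`), so
`V Σ⁻¹ Uᵀ` is a left inverse of the level (`levelPinv_mul_level`).

For the cross-quadrant level `S`, the truncation `M` deletes exactly the cells in which pixels of
different `2 × 2` blocks are added. What remains acts on each block separately, and a finite check
on the four patterns gives `Sᵀ M W = V (Q D² Qᵀ)` (`crossLevel_transpose_mul`). With `V Vᵀ = 1` this
yields `V̂ Ûᵀ S = 1`.

No fast sine transform is needed for the operation count, because the trigonometric functions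
cancel from the products. The matrix `V Σ⁻¹ Uᵀ` of a convolution block inverts `K` on its range and
kills the alternating vector, which spans the orthogonal complement of the range. Hence it is
applied in linear time by removing the alternating component and substituting forward
(`convPinv_mulVec`). The completeness of the sinusoids makes `V̂ Ûᵀ` sparse: at most `16` nonzero
entries in a row (`card_support_crossVHat_mul_crossUHat_transpose`). Each of the `n` factors
therefore costs `O(N²)` operations, and the total `O(N² log N)` is within the required bound.
-/

namespace ADRT

/-! ### The discrete sine transform -/

/-- The closed form of the Dirichlet kernel, by telescoping. -/
theorem two_sin_half_mul_sum_cos (x : ℝ) (t : ℕ) :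
    2 * Real.sin (x / 2) * ∑ k ∈ Finset.range t, Real.cos (((k : ℝ) + 1) * x) =
      Real.sin (((t : ℝ) + 1 / 2) * x) - Real.sin (x / 2) := by
  induction t with
  | zero => simp; ring_nf
  | succ t ih =>
    rw [Finset.sum_range_succ, mul_add, ih]
    have h1 : ((t + 1 : ℕ) + 1 / 2 : ℝ) * x = ((t : ℝ) + 1) * x + x / 2 := by push_cast; ring
    have h2 : ((t : ℝ) + 1 / 2) * x = ((t : ℝ) + 1) * x - x / 2 := by ring
    rw [h1, h2, Real.sin_add, Real.sin_sub]
    ring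

/-- Away from the multiples of `2 (t + 1)` the sum of cosines depends on the parity of the frequency
only. -/
theorem sum_cos_int_mul (t : ℕ) (m : ℤ) (hm : m ≠ 0) (hlo : -(2 * (t + 1) : ℤ) < m)
    (hhi : m < 2 * (t + 1)) :
    ∑ k ∈ Finset.range t, Real.cos (((k : ℝ) + 1) * (m * Real.pi / (t + 1))) =
      (-(-1 : ℝ) ^ m - 1) / 2 := by
  have ht : (0 : ℝ) < (t : ℝ) + 1 := by positivity
  set x : ℝ := m * Real.pi / (t + 1) with hx
  have hs : Real.sin (x / 2) ≠ 0 := by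
    intro h
    obtain ⟨r, hr⟩ := Real.sin_eq_zero_iff.1 h
    have h1 : (r : ℝ) * (2 * (t + 1)) = m := by
      have : (r : ℝ) * Real.pi * (2 * (t + 1)) = m * Real.pi := by
        rw [hr, hx]; field_simp
      have hp := Real.pi_ne_zero
      apply mul_right_cancel₀ hp
      linarith
    have h2 : r * (2 * ((t : ℤ) + 1)) = m := by exact_mod_cast h1
    have hr1 : -1 < r := by nlinarith
    have hr2 : r < 1 := by nlinarith
    have : r = 0 := by omega
    subst this
    simp at h2
    omega
  have h := two_sin_half_mul_sum_cos x t
  have h3 : ((t : ℝ) + 1 / 2) * x = m * Real.pi - x / 2 := by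
    rw [hx]; field_simp; ring
  rw [h3, Real.sin_sub, Real.sin_int_mul_pi, Real.cos_int_mul_pi] at h
  apply mul_left_cancel₀ (mul_ne_zero two_ne_zero hs)
  rw [h]; ring

/-- The sine vectors `convV t` are orthonormal: the product formula reduces the entries to sums
of cosines at two frequencies of equal parity, which cancel off the diagonal. -/
theorem convV_mul_transpose (t : ℕ) : convV t * (convV t)ᵀ = 1 := by
  have ht : (0 : ℝ) < (t : ℝ) + 1 := by positivity
  ext i j
  rw [Matrix.mul_apply]
  have hi := i.2
  have hj := j.2
  have key : ∀ k : Fin t, convV t i k * (convV t)ᵀ k j =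
      1 / (t + 1) * (Real.cos (((k : ℕ) + 1 : ℝ) * ((((i : ℕ) : ℤ) - (j : ℕ) : ℤ) * Real.pi / (t + 1)))
        - Real.cos (((k : ℕ) + 1 : ℝ) * ((((i : ℕ) : ℤ) + (j : ℕ) + 2 : ℤ) * Real.pi / (t + 1)))) := by
    intro k
    simp only [convV, Matrix.transpose_apply, Matrix.of_apply]
    have hsq : √(2 / ((t : ℝ) + 1)) * √(2 / ((t : ℝ) + 1)) = 2 / (t + 1) :=
      Real.mul_self_sqrt (by positivity)
    set a := ((k : ℝ) + 1) * Real.pi * ((i : ℝ) + 1) / ((t : ℝ) + 1) with ha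
    set b := ((k : ℝ) + 1) * Real.pi * ((j : ℝ) + 1) / ((t : ℝ) + 1) with hb
    have h1 : ((k : ℕ) + 1 : ℝ) * ((((i : ℕ) : ℤ) - (j : ℕ) : ℤ) * Real.pi / (t + 1)) = a - b := by
      rw [ha, hb]; push_cast; ring
    have h2 : ((k : ℕ) + 1 : ℝ) * ((((i : ℕ) : ℤ) + (j : ℕ) + 2 : ℤ) * Real.pi / (t + 1)) = a + b := by
      rw [ha, hb]; push_cast; ring
    rw [h1, h2, Real.cos_sub, Real.cos_add]
    calc _ = (√(2 / ((t : ℝ) + 1)) * √(2 / ((t : ℝ) + 1))) * (Real.sin a * Real.sin b) := by ring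
      _ = _ := by rw [hsq]; ring
  rw [Finset.sum_congr rfl fun k _ => key k, ← Finset.mul_sum, Finset.sum_sub_distrib,
    Fin.sum_univ_eq_sum_range
      (fun k => Real.cos (((k : ℕ) + 1 : ℝ) * ((((i : ℕ) : ℤ) - (j : ℕ) : ℤ) * Real.pi / (t + 1)))) t,
    Fin.sum_univ_eq_sum_range
      (fun k => Real.cos (((k : ℕ) + 1 : ℝ) * ((((i : ℕ) : ℤ) + (j : ℕ) + 2 : ℤ) * Real.pi / (t + 1)))) t,
    sum_cos_int_mul t (((i : ℕ) : ℤ) + (j : ℕ) + 2) (by omega) (by omega) (by omega)]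
  by_cases hij : i = j
  · subst hij
    rw [Matrix.one_apply_eq]
    have he : (-1 : ℝ) ^ (((i : ℕ) : ℤ) + (i : ℕ) + 2) = 1 :=
      Even.neg_one_zpow ⟨(i : ℕ) + 1, by ring⟩
    rw [he]
    simp only [sub_self, Int.cast_zero, zero_mul, zero_div, mul_zero, Real.cos_zero,
      Finset.sum_const, Finset.card_range, nsmul_eq_mul, mul_one]
    field_simp
    ring
  · rw [Matrix.one_apply_ne hij, sum_cos_int_mul t (((i : ℕ) : ℤ) - (j : ℕ))
      (by have := Fin.val_ne_of_ne hij; omega) (by omega) (by omega)]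
    have he : (-1 : ℝ) ^ (((i : ℕ) : ℤ) + (j : ℕ) + 2) = (-1 : ℝ) ^ (((i : ℕ) : ℤ) - (j : ℕ)) := by
      have : ((i : ℕ) : ℤ) + (j : ℕ) + 2 = (((i : ℕ) : ℤ) - (j : ℕ)) + 2 * ((j : ℕ) + 1) := by ring
      rw [this, zpow_add₀ (by norm_num), zpow_mul]
      norm_num
    rw [he]
    ring

/-! ### The convolution matrix with kernel `[1, 1]` and its pseudo-inverse -/

/-- The `(t+1) × t` convolution matrix with kernel `[1, 1]`. -/
noncomputable def convK (t : ℕ) : Matrix (Fin (t + 1)) (Fin t) ℝ :=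
  Matrix.of fun i c => (if (i : ℕ) = c then 1 else 0) + (if (i : ℕ) = c + 1 then 1 else 0)

theorem convSigma_pos (t : ℕ) (k : Fin t) : 0 < convSigma t k := by
  have hk : ((k : ℕ) : ℝ) + 1 ≤ t := by exact_mod_cast k.2
  have ht : (0 : ℝ) < 2 * t + 2 := by positivity
  refine mul_pos two_pos (Real.cos_pos_of_mem_Ioo ⟨?_, ?_⟩)
  · have : 0 < ((k : ℝ) + 1) * Real.pi / (2 * (t : ℝ) + 2) := by positivity
    linarith [Real.pi_pos]
  · rw [div_lt_iff₀ ht]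
    nlinarith [Real.pi_pos]

/-- The addition theorem for the sine, in the form `Uᵀ K = Σ Vᵀ`. -/
theorem convU_transpose_mul_convK (t : ℕ) :
    (convU t)ᵀ * convK t = Matrix.diagonal (convSigma t) * (convV t)ᵀ := by
  have ht : (0 : ℝ) < (t : ℝ) + 1 := by positivity
  ext k c
  rw [Matrix.diagonal_mul, Matrix.mul_apply]
  have h1 : ∑ i, (convU t)ᵀ k i * convK t i c = convU t c.castSucc k + convU t c.succ k := by
    simp only [convK, Matrix.transpose_apply, Matrix.of_apply, mul_add, Finset.sum_add_distrib]
    congr 1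
    · rw [Finset.sum_eq_single c.castSucc]
      · simp
      · intro i _ hi
        rw [if_neg (fun h => hi (Fin.ext (by simpa using h))), mul_zero]
      · simp
    · rw [Finset.sum_eq_single c.succ]
      · simp
      · intro i _ hi
        rw [if_neg (fun h => hi (Fin.ext (by simpa using h))), mul_zero]
      · simp
  rw [h1]
  simp only [convU, convV, convSigma, Matrix.transpose_apply, Matrix.of_apply, Fin.val_castSucc,
    Fin.val_succ, Nat.cast_add, Nat.cast_one]
  set a := ((k : ℝ) + 1) * Real.pi * ((c : ℝ) + 1) / ((t : ℝ) + 1) with ha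
  set d := ((k : ℝ) + 1) * Real.pi / (2 * (t : ℝ) + 2) with hd
  have e1 : ((k : ℝ) + 1) * Real.pi * ((c : ℝ) + 1 / 2) / ((t : ℝ) + 1) = a - d := by
    rw [ha, hd]; field_simp; ring
  have e2 : ((k : ℝ) + 1) * Real.pi * ((c : ℝ) + 1 + 1 / 2) / ((t : ℝ) + 1) = a + d := by
    rw [ha, hd]; field_simp
  rw [e1, e2, Real.sin_sub, Real.sin_add]
  ring

/-- The alternating vector is orthogonal to the range of the convolution matrix. -/
theorem sum_neg_one_pow_mul_convU (t : ℕ) (k : Fin t) :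
    ∑ i : Fin (t + 1), (-1 : ℝ) ^ (i : ℕ) * convU t i k = 0 := by
  have ht : (0 : ℝ) < (t : ℝ) + 1 := by positivity
  apply mul_left_cancel₀ (convSigma_pos t k).ne'
  rw [mul_zero, Finset.mul_sum]
  set θ : ℝ := ((k : ℝ) + 1) * Real.pi / ((t : ℝ) + 1) with hθ
  have key : ∀ i : Fin (t + 1), convSigma t k * ((-1 : ℝ) ^ (i : ℕ) * convU t i k) =
      √(2 / ((t : ℝ) + 1)) * ((-1) ^ (i : ℕ) * (Real.sin (((i : ℕ) + 1) * θ) +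
        Real.sin ((i : ℕ) * θ))) := by
    intro i
    simp only [convU, convSigma, Matrix.of_apply]
    have e1 : ((i : ℕ) + 1) * θ =
      ((k : ℝ) + 1) * Real.pi * ((i : ℝ) + 1 / 2) / ((t : ℝ) + 1) +
        ((k : ℝ) + 1) * Real.pi / (2 * (t : ℝ) + 2) := by rw [hθ]; field_simp; ring
    have e2 : (i : ℕ) * θ =
      ((k : ℝ) + 1) * Real.pi * ((i : ℝ) + 1 / 2) / ((t : ℝ) + 1) -
        ((k : ℝ) + 1) * Real.pi / (2 * (t : ℝ) + 2) := by rw [hθ]; field_simp; ring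
    rw [e1, e2, Real.sin_sub, Real.sin_add]
    ring
  rw [Finset.sum_congr rfl fun i _ => key i, ← Finset.mul_sum, Fin.sum_univ_eq_sum_range
    (fun i => (-1 : ℝ) ^ i * (Real.sin (((i : ℕ) + 1) * θ) + Real.sin ((i : ℕ) * θ))) (t + 1)]
  have tele : ∀ r : ℕ, ∑ i ∈ Finset.range r,
      (-1 : ℝ) ^ i * (Real.sin (((i : ℕ) + 1) * θ) + Real.sin ((i : ℕ) * θ)) =
        -(-1) ^ r * Real.sin (r * θ) := by
    intro r
    induction r with
    | zero => simp
    | succ r ih => rw [Finset.sum_range_succ, ih]; push_cast; ring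
  rw [tele]
  have e3 : ((t + 1 : ℕ) : ℝ) * θ = ((k : ℕ) + 1 : ℕ) * Real.pi := by
    rw [hθ]; push_cast; field_simp
  rw [e3, Real.sin_nat_mul_pi]
  simp

/-- The pseudo-inverse of the convolution matrix, read off its singular value decomposition. -/
noncomputable def convPinv (t : ℕ) : Matrix (Fin t) (Fin (t + 1)) ℝ :=
  convV t * Matrix.diagonal (fun k => (convSigma t k)⁻¹) * (convU t)ᵀ

theorem convPinv_mul_convK (t : ℕ) : convPinv t * convK t = 1 := by
  rw [convPinv, Matrix.mul_assoc, convU_transpose_mul_convK, Matrix.mul_assoc,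
    ← Matrix.mul_assoc (Matrix.diagonal _), Matrix.diagonal_mul_diagonal]
  simp only [inv_mul_cancel₀ (convSigma_pos t _).ne']
  rw [Matrix.diagonal_one, Matrix.one_mul, convV_mul_transpose]

theorem convPinv_mulVec_alternating (t : ℕ) :
    convPinv t *ᵥ (fun i => (-1 : ℝ) ^ (i : ℕ)) = 0 := by
  have : (convU t)ᵀ *ᵥ (fun i => (-1 : ℝ) ^ (i : ℕ)) = 0 := by
    ext k
    simp only [Matrix.mulVec, dotProduct, Matrix.transpose_apply, Pi.zero_apply]
    rw [← sum_neg_one_pow_mul_convU t k]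
    exact Finset.sum_congr rfl fun i _ => mul_comm _ _
  rw [convPinv, ← Matrix.mulVec_mulVec, this, Matrix.mulVec_zero]

/-- Mean of the alternating signs times the data: the coefficient of the projection of `z` onto the
orthogonal complement of the range of the convolution matrix. -/
noncomputable def altMean (t : ℕ) (z : ℕ → ℝ) : ℝ :=
  (1 / ((t : ℝ) + 1)) * ∑ i ∈ Finset.range (t + 1), (-1 : ℝ) ^ i * z i

/-- Forward substitution for the convolution equation, after the projection of the data onto the
range of the convolution matrix. -/
noncomputable def deconv (t : ℕ) (z : ℕ → ℝ) : ℕ → ℝ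
  | 0 => z 0 - altMean t z
  | i + 1 => (z (i + 1) - (-1) ^ (i + 1) * altMean t z) - deconv t z i

/-- With alternating signs the substitution becomes a partial sum. -/
theorem neg_one_pow_mul_deconv (t : ℕ) (z : ℕ → ℝ) (r : ℕ) :
    (-1 : ℝ) ^ r * deconv t z r =
      ∑ i ∈ Finset.range (r + 1), (-1 : ℝ) ^ i * z i - (r + 1) * altMean t z := by
  induction r with
  | zero => simp [deconv]
  | succ r ih =>
    rw [Finset.sum_range_succ, deconv]
    have h : ((-1 : ℝ) ^ (r + 1)) * (-1) ^ (r + 1) = 1 := by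
      rw [← mul_pow]; norm_num
    have e : (-1 : ℝ) ^ (r + 1) * (z (r + 1) - (-1) ^ (r + 1) * altMean t z - deconv t z r) =
      (-1 : ℝ) ^ (r + 1) * z (r + 1) - ((-1 : ℝ) ^ (r + 1) * (-1) ^ (r + 1)) * altMean t z +
        (-1) ^ r * deconv t z r := by ring
    rw [e, h, ih]
    push_cast
    ring

/-- The last row of the convolution equation, which the substitution does not solve, is satisfied
because the projected data lie in the range. -/
theorem deconv_last (t : ℕ) (z : ℕ → ℝ) : deconv t z t = 0 := by
  have h := neg_one_pow_mul_deconv t z t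
  have ht : (t : ℝ) + 1 ≠ 0 := by positivity
  have h2 : ((t : ℝ) + 1) * altMean t z = ∑ i ∈ Finset.range (t + 1), (-1 : ℝ) ^ i * z i := by
    rw [altMean]; field_simp
  rw [← h2, sub_self] at h
  exact (mul_eq_zero.1 h).resolve_left (pow_ne_zero _ (by norm_num))

/-- The pseudo-inverse of the convolution matrix is applied in linear time, without any
trigonometric transform: subtract the multiple of the alternating vector, then substitute. -/
theorem convPinv_mulVec (t : ℕ) (z : ℕ → ℝ) (k : Fin t) :
    (convPinv t *ᵥ fun i => z i) k = deconv t z k := by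
  have hz : (fun i : Fin (t + 1) => z i) =
      convK t *ᵥ (fun c => deconv t z c) + altMean t z • (fun i : Fin (t + 1) => (-1 : ℝ) ^ (i : ℕ)) := by
    ext i
    simp only [Pi.add_apply, Pi.smul_apply, smul_eq_mul, Matrix.mulVec, dotProduct, convK,
      Matrix.of_apply, add_mul, ite_mul, one_mul, zero_mul, Finset.sum_add_distrib]
    have h1 : ∑ c : Fin t, (if (i : ℕ) = c then deconv t z c else 0) = deconv t z i := by
      rcases Nat.lt_succ_iff_lt_or_eq.1 i.2 with h | h
      · rw [Finset.sum_eq_single ⟨i, h⟩]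
        · simp
        · intro c _ hc
          exact if_neg fun h => hc (Fin.ext h.symm)
        · simp
      · rw [h, deconv_last]
        exact Finset.sum_eq_zero fun c _ => if_neg c.2.ne'
    rw [h1]
    obtain ⟨i, hi⟩ := i
    cases i with
    | zero =>
      have : ∑ c : Fin t, (if (0 : ℕ) = c + 1 then deconv t z c else 0) = 0 :=
        Finset.sum_eq_zero fun c _ => if_neg (by omega)
      simp only [this, deconv]
      ring
    | succ i =>
      have : ∑ c : Fin t, (if i + 1 = (c : ℕ) + 1 then deconv t z c else 0) = deconv t z i := by
        rw [Finset.sum_eq_single ⟨i, by omega⟩]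
        · simp
        · intro c _ hc
          exact if_neg fun h => hc (Fin.ext (by simpa using h.symm))
        · simp
      simp only [this, deconv]
      ring
  rw [hz, Matrix.mulVec_add, Matrix.mulVec_smul, convPinv_mulVec_alternating, smul_zero, add_zero,
    Matrix.mulVec_mulVec, convPinv_mul_convK, Matrix.one_mulVec]

/-! ### Listing the cells of a level -/

theorem mem_E {n m : ℕ} (hm : m ≤ n) {h : ℤ} {c : ℕ} :
    (h, c) ∈ E n m ↔ -((c % 2 ^ m : ℕ) : ℤ) ≤ h ∧ h < 2 ^ n ∧ c < 2 ^ n := by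
  simp only [E, Finset.mem_filter, Finset.mem_product, Finset.mem_Ico, Finset.mem_range]
  have h1 : c % 2 ^ m < 2 ^ m := Nat.mod_lt _ (by positivity)
  have h2 : 2 ^ m ≤ 2 ^ n := Nat.pow_le_pow_right two_pos hm
  have h3 : ((2 ^ n : ℕ) : ℤ) = (2 : ℤ) ^ n := by push_cast; rfl
  constructor
  · rintro ⟨⟨⟨_, a⟩, b⟩, c⟩; exact ⟨c, a, b⟩
  · rintro ⟨a, b, c⟩; exact ⟨⟨⟨by omega, b⟩, c⟩, a⟩

/-- A column number determines its half section and its place there. -/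
theorem column_inj {j a b s t : ℕ} (hs : s < 2 ^ j) (ht : t < 2 ^ j)
    (h : a * 2 ^ j + s = b * 2 ^ j + t) : a = b ∧ s = t := by
  have h1 := congrArg (· / 2 ^ j) h
  have h2 := congrArg (· % 2 ^ j) h
  simpa [Nat.mul_add_mod', Nat.mod_eq_of_lt, Nat.mul_add_div, Nat.div_eq_of_lt, hs, ht,
    mul_comm _ (2 ^ j)] using And.intro h1 h2

theorem column_lt {n j l d s : ℕ} (hj : j + 1 ≤ n) (hl : l < 2 ^ (n - (j + 1))) (hd : d < 2)
    (hs : s < 2 ^ j) : (2 * l + d) * 2 ^ j + s < 2 ^ n := by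
  have h1 : 2 ^ n = (2 * 2 ^ (n - (j + 1))) * 2 ^ j := by
    rw [← pow_succ', ← pow_add]; congr 1; omega
  rw [h1]
  calc (2 * l + d) * 2 ^ j + s < (2 * l + d + 1) * 2 ^ j := by rw [add_mul _ 1]; omega
    _ ≤ _ := Nat.mul_le_mul_right _ (by omega)

theorem column_mod {j a s : ℕ} (hs : s < 2 ^ j) : (a * 2 ^ j + s) % 2 ^ j = s := by
  rw [Nat.mul_add_mod', Nat.mod_eq_of_lt hs]

theorem colCell_mem {n j : ℕ} (hj : j + 1 ≤ n) (x : FlatCol n j) :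
    colCell n j x.1 x.2.1 x.2.2 ∈ E n j := by
  obtain ⟨l, s, c⟩ := x
  have hs := s.2
  have hl := l.2
  have h2 : 2 ^ j ≤ 2 ^ n := Nat.pow_le_pow_right two_pos (by omega)
  have h3 : ((2 ^ n : ℕ) : ℤ) = (2 : ℤ) ^ n := by push_cast; rfl
  have hu := column_lt hj hl (d := 0) (by omega) hs
  have hv := column_lt hj hl (d := 1) (by omega) hs
  rcases c with a | c | a
  · have ha := a.2
    simp only [colCell]
    rw [mem_E (by omega), column_mod hs]
    omega
  · have hc := c.2
    simp only [colCell]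
    split_ifs
    all_goals
      rw [mem_E (by omega), column_mod hs]
      rw [add_zero] at hu
      omega
  · have ha := a.2
    simp only [colCell]
    rw [mem_E (by omega), column_mod hs]
    rw [add_zero] at hu
    omega

/-- Within a block, the position in the list determines the row index of a cell and the half
section (`δ = 1` for the second one) it belongs to. -/
theorem colCell_eq (n j l s : ℕ) (x : BlockCol n s) : ∃ δ : ℕ, δ < 2 ∧
    (colCell n j l s x).2 = (2 * l + δ) * 2 ^ j + s ∧
    match x with
    | Sum.inl a => δ = 1 ∧ (colCell n j l s x).1 = (a : ℤ) - s
    | Sum.inr (Sum.inl c) => (δ = 1 ∧ (c : ℤ) = 2 * (colCell n j l s x).1) ∨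
        (δ = 0 ∧ (c : ℤ) = 2 * ((colCell n j l s x).1 + s) + 1)
    | Sum.inr (Sum.inr a) => δ = 0 ∧ (colCell n j l s x).1 = 2 ^ n - s + a := by
  rcases x with a | c | a
  · exact ⟨1, by omega, rfl, rfl, rfl⟩
  · rcases Nat.mod_two_eq_zero_or_one c with h | h
    · refine ⟨1, by omega, by simp [colCell, h], Or.inl ⟨rfl, ?_⟩⟩
      simp only [colCell, if_pos h]
      omega
    · refine ⟨0, by omega, by simp [colCell, h], Or.inr ⟨rfl, ?_⟩⟩
      have h0 : ¬ ((c : ℕ) % 2 = 0) := by omega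
      simp only [colCell, if_neg h0]
      omega
  · exact ⟨0, by omega, rfl, rfl, rfl⟩

theorem colCell_injective {n j : ℕ} :
    Function.Injective fun x : FlatCol n j => colCell n j x.1 x.2.1 x.2.2 := by
  rintro ⟨l, s, x⟩ ⟨l', s', x'⟩ h
  simp only at h
  obtain ⟨δ, hδ, h1, h2⟩ := colCell_eq n j l s x
  obtain ⟨δ', hδ', h1', h2'⟩ := colCell_eq n j l' s' x'
  rw [h] at h1
  obtain ⟨e1, e2⟩ := column_inj s.2 s'.2 (h1.symm.trans h1')
  obtain rfl : l = l' := Fin.ext (by omega)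
  obtain rfl : s = s' := Fin.ext e2
  rw [h] at h2
  generalize (colCell n j l s x').1 = r at h2 h2'
  have h3 : ((2 ^ n : ℕ) : ℤ) = (2 : ℤ) ^ n := by push_cast; rfl
  congr 2
  rcases x with a | a | a <;> rcases x' with b | b | b <;> dsimp only at h2 h2' <;>
    have ha := a.2 <;> have hb := b.2 <;>
    first
    | (have : (a : ℕ) = b := by omega
       simpa [Fin.ext_iff] using this)
    | (exfalso; omega)

theorem colCell_surjective {n j : ℕ} (hj : j + 1 ≤ n) (e : E n j) :
    ∃ x : FlatCol n j, e.1 = colCell n j x.1 x.2.1 x.2.2 := by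
  obtain ⟨⟨h, c⟩, he⟩ := e
  rw [mem_E (by omega)] at he
  obtain ⟨he1, he2, he3⟩ := he
  have h3 : ((2 ^ n : ℕ) : ℤ) = (2 : ℤ) ^ n := by push_cast; rfl
  have hs : c % 2 ^ j < 2 ^ j := Nat.mod_lt _ (by positivity)
  have h2 : 2 ^ j ≤ 2 ^ n := Nat.pow_le_pow_right two_pos (by omega)
  have hc : c = (c / 2 ^ j) * 2 ^ j + c % 2 ^ j := (Nat.div_add_mod' c _).symm
  have hl : c / 2 ^ j / 2 < 2 ^ (n - (j + 1)) := by
    rw [Nat.div_div_eq_div_mul, ← pow_succ]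
    apply Nat.div_lt_of_lt_mul
    rwa [← pow_add, Nat.add_sub_cancel' hj]
  set s := c % 2 ^ j with hsdef
  set l := c / 2 ^ j / 2 with hldef
  rcases Nat.mod_two_eq_zero_or_one (c / 2 ^ j) with hd | hd
  · have hcl : c / 2 ^ j = 2 * l := by omega
    rw [hcl] at hc
    by_cases hh : h < 2 ^ n - s
    · refine ⟨⟨⟨l, hl⟩, ⟨s, hs⟩, Sum.inr (Sum.inl ⟨(2 * (h + s) + 1).toNat, by omega⟩)⟩, ?_⟩
      have : ¬ ((2 * (h + s) + 1).toNat % 2 = 0) := by omega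
      simp only [colCell, if_neg this, Prod.mk.injEq]
      exact ⟨by omega, hc⟩
    · refine ⟨⟨⟨l, hl⟩, ⟨s, hs⟩, Sum.inr (Sum.inr ⟨(h - (2 ^ n - s)).toNat, by dsimp only; omega⟩)⟩, ?_⟩
      simp only [colCell, Prod.mk.injEq]
      exact ⟨by omega, hc⟩
  · have hcl : c / 2 ^ j = 2 * l + 1 := by omega
    rw [hcl] at hc
    by_cases hh : h < 0
    · refine ⟨⟨⟨l, hl⟩, ⟨s, hs⟩, Sum.inl ⟨(h + s).toNat, by dsimp only; omega⟩⟩, ?_⟩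
      simp only [colCell, Prod.mk.injEq]
      exact ⟨by omega, hc⟩
    · refine ⟨⟨⟨l, hl⟩, ⟨s, hs⟩, Sum.inr (Sum.inl ⟨(2 * h).toNat, by omega⟩)⟩, ?_⟩
      have : (2 * h).toNat % 2 = 0 := by omega
      simp only [colCell, if_pos this, Prod.mk.injEq]
      exact ⟨by omega, hc⟩

theorem rowPos_bounds (n s : ℕ) (y : BlockRow n s) :
    -(2 * s : ℤ) ≤ rowPos n s y ∧ rowPos n s y ≤ 2 * 2 ^ n + 2 * s := by
  have h3 : ((2 ^ n : ℕ) : ℤ) = (2 : ℤ) ^ n := by push_cast; rfl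
  have h4 : (0 : ℤ) < 2 ^ n := by positivity
  rcases y with a | i | a
  · have := a.1.2; have := a.2.2; simp only [rowPos]; omega
  · have := i.2; simp only [rowPos]; omega
  · have := a.1.2; have := a.2.2; simp only [rowPos]; omega

theorem rowCell_column {n j l s : ℕ} (hs : s < 2 ^ j) (y : BlockRow n s) :
    (rowCell n j l s y).2 % 2 ^ (j + 1) =
      2 * s + ((rowPos n s y - (2 * s + 1)) % 2).toNat := by
  simp only [rowCell, add_assoc]
  rw [Nat.mul_add_mod', Nat.mod_eq_of_lt]
  rw [pow_succ]; omega

theorem rowCell_mem {n j : ℕ} (hj : j + 1 ≤ n) (y : FlatRow n j) :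
    rowCell n j y.1 y.2.1 y.2.2 ∈ E n (j + 1) := by
  obtain ⟨l, s, y⟩ := y
  have hs := s.2
  have hl := l.2
  have hb := rowPos_bounds n s y
  have hc := rowCell_column (l := l) hs y
  have hlt : (rowCell n j l s y).2 < 2 ^ n := by
    have h1 : 2 ^ n = 2 ^ (n - (j + 1)) * 2 ^ (j + 1) := by
      rw [← pow_add]; congr 1; omega
    have h2 : (rowCell n j l s y).2 / 2 ^ (j + 1) < 2 ^ (n - (j + 1)) := by
      simp only [rowCell, add_assoc]
      rw [mul_comm, Nat.mul_add_div (by positivity), Nat.div_eq_of_lt (by rw [pow_succ]; omega)]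
      exact hl
    rw [h1]
    exact (Nat.div_lt_iff_lt_mul (by positivity)).1 h2
  show ((rowCell n j l s y).1, (rowCell n j l s y).2) ∈ _
  rw [mem_E hj, hc]
  refine ⟨?_, ?_, hlt⟩
  · simp only [rowCell]; omega
  · simp only [rowCell]; omega

/-- As `colCell` is injective, at most one position of the lists contributes to a cell. -/
theorem flatten_transpose_mul_apply {n j : ℕ} {κ : Type} (M : Matrix (FlatCol n j) κ ℝ)
    {e : E n j} {x : FlatCol n j} (h : e.1 = colCell n j x.1 x.2.1 x.2.2) (k : κ) :
    ((flatten n j)ᵀ * M) e k = M x k := by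
  rw [Matrix.mul_apply, Finset.sum_eq_single x]
  · simp [flatten, h]
  · intro x' _ hx
    rw [Matrix.transpose_apply, flatten, Matrix.of_apply, if_neg, zero_mul]
    intro h'
    exact hx (colCell_injective (h'.symm.trans h))
  · simp

theorem flatten_transpose_mul_flatten {n j : ℕ} (hj : j + 1 ≤ n) :
    (flatten n j)ᵀ * flatten n j = 1 := by
  ext e e'
  obtain ⟨x, hx⟩ := colCell_surjective hj e
  rw [flatten_transpose_mul_apply _ hx, flatten, Matrix.of_apply, ← hx, Matrix.one_apply]
  exact if_congr ⟨fun h => Subtype.ext h.symm, fun h => h ▸ rfl⟩ rfl rfl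

theorem mul_flatten_transpose_apply {n j : ℕ} (hj : j + 1 ≤ n) {κ : Type} (M : Matrix κ (E n j) ℝ)
    (k : κ) (x : FlatCol n j) :
    (M * (flatten n j)ᵀ) k x = M k ⟨colCell n j x.1 x.2.1 x.2.2, colCell_mem hj x⟩ := by
  rw [Matrix.mul_apply, Finset.sum_eq_single ⟨colCell n j x.1 x.2.1 x.2.2, colCell_mem hj x⟩]
  · simp [flatten]
  · intro e _ he
    rw [Matrix.transpose_apply, flatten, Matrix.of_apply, if_neg, mul_zero]
    exact fun h => he (Subtype.ext h)
  · simp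

theorem unflatten_transpose_mul_apply {n j : ℕ} (hj : j + 1 ≤ n) {κ : Type}
    (M : Matrix (E n (j + 1)) κ ℝ) (y : FlatRow n j) (k : κ) :
    ((unflatten n j)ᵀ * M) y k = M ⟨rowCell n j y.1 y.2.1 y.2.2, rowCell_mem hj y⟩ k := by
  rw [Matrix.mul_apply, Finset.sum_eq_single ⟨rowCell n j y.1 y.2.1 y.2.2, rowCell_mem hj y⟩]
  · simp [unflatten]
  · intro e _ he
    rw [Matrix.transpose_apply, unflatten, Matrix.of_apply, if_neg, zero_mul]
    exact fun h => he (Subtype.ext h)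
  · simp

/-- The block `diag [H_s, K_{2N}, H_s]`, with the columns of `H_s` not normalised. -/
noncomputable def blockK (n s : ℕ) : Matrix (BlockRow n s) (BlockCol n s) ℝ :=
  Matrix.fromBlocks (Matrix.of fun a b => if a.1 = b then 1 else 0) 0 0
    (Matrix.fromBlocks (convK (2 * 2 ^ n)) 0 0 (Matrix.of fun a b => if a.1 = b then 1 else 0))

/-- The value `level n j` takes between two cells of one block: the first and the second term pick
the cell in the first and in the second half section. -/
theorem level_rowCell {n j l s : ℕ} (hs : s < 2 ^ j) (y : BlockRow n s)
    (hy : rowCell n j l s y ∈ E n (j + 1)) (f : E n j) :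
    level n j ⟨rowCell n j l s y, hy⟩ f =
      (if f.1 = ((rowPos n s y - (2 * s + 1)) / 2, (2 * l + 0) * 2 ^ j + s) then 1 else 0) +
      (if f.1 = ((rowPos n s y - (2 * s + 1)) / 2 + s + (rowPos n s y - (2 * s + 1)) % 2,
        (2 * l + 1) * 2 ^ j + s) then 1 else 0) := by
  have hc := rowCell_column (l := l) hs y
  have hd : (rowCell n j l s y).2 / 2 ^ (j + 1) = l := by
    simp only [rowCell, add_assoc]
    rw [mul_comm, Nat.mul_add_div (by positivity), Nat.div_eq_of_lt (by rw [pow_succ]; omega)]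
    rfl
  have he : (rowCell n j l s y).2 % 2 = ((rowPos n s y - (2 * s + 1)) % 2).toNat := by
    rw [← Nat.mod_mod_of_dvd _ (Dvd.intro_left (2 ^ j) (pow_succ 2 j).symm), hc]
    omega
  simp only [level, Matrix.of_apply]
  rw [hc, hd, he]
  have h1 : (2 * s + ((rowPos n s y - (2 * s + 1)) % 2).toNat) / 2 = s := by omega
  have h2 : ((((rowPos n s y - (2 * s + 1)) % 2).toNat : ℕ) : ℤ) =
    (rowPos n s y - (2 * s + 1)) % 2 := by omega
  rw [h1, h2]
  rfl

/-- In the listed order a level is block diagonal: position `p` of a block receives the entries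
`p - 1` and `p` of the alternating list, and the two ends of the list are merely doubled. -/
theorem unflatten_level_flatten {n j : ℕ} (hj : j + 1 ≤ n) :
    (unflatten n j)ᵀ * level n j * (flatten n j)ᵀ =
      (1 : Matrix (Fin (2 ^ (n - (j + 1)))) (Fin (2 ^ (n - (j + 1)))) ℝ) ⊗ₖ
        Matrix.blockDiagonal' (fun s : Fin (2 ^ j) => blockK n s) := by
  ext ⟨l, s, y⟩ ⟨l', s', x⟩
  rw [mul_flatten_transpose_apply hj, unflatten_transpose_mul_apply hj]
  simp only [Matrix.kroneckerMap_apply]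
  rw [level_rowCell s.2]
  obtain ⟨δ, hδ, h1, h2⟩ := colCell_eq n j l' s' x
  obtain ⟨⟨r, col⟩, hcell⟩ : ∃ cell, colCell n j l' s' x = cell := ⟨_, rfl⟩
  rw [hcell] at h1 h2
  dsimp only at h1 h2
  subst h1
  simp only [hcell]
  by_cases hls : l = l' ∧ s = s'
  · obtain ⟨rfl, rfl⟩ := hls
    rw [Matrix.one_apply_eq, one_mul, Matrix.blockDiagonal'_apply_eq]
    have e1 : ∀ (z : ℤ) (d : ℕ), (((r, (2 * (l : ℕ) + δ) * 2 ^ j + (s : ℕ)) : ℤ × ℕ) =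
        (z, (2 * l + d) * 2 ^ j + s)) ↔ r = z ∧ δ = d := by
      intro z d
      rw [Prod.mk.injEq]
      refine and_congr_right fun _ => ⟨fun h => ?_, fun h => by rw [h]⟩
      have := (column_inj s.2 s.2 h).1
      omega
    simp only [e1]
    obtain ⟨p, hp⟩ : ∃ p, rowPos n s y = p := ⟨_, rfl⟩
    rw [hp]
    have h3 : ((2 ^ n : ℕ) : ℤ) = (2 : ℤ) ^ n := by push_cast; rfl
    have h4 : (0 : ℤ) < 2 ^ n := by positivity
    rcases x with a | a | a <;> rcases y with b | b | b <;> dsimp only at h2 <;>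
      simp only [rowPos] at hp <;>
      simp only [blockK, Matrix.fromBlocks_apply₁₁, Matrix.fromBlocks_apply₁₂,
        Matrix.fromBlocks_apply₂₁, Matrix.fromBlocks_apply₂₂, convK, Matrix.of_apply,
        Matrix.zero_apply, Fin.ext_iff]
    · have := a.2; have := b.1.2; have := b.2.2
      rw [if_neg (by omega), zero_add]
      exact if_congr (by omega) rfl rfl
    · have := a.2; have := b.2
      rw [if_neg (by omega), if_neg (by omega), zero_add]
    · have := a.2; have := b.1.2; have := b.2.2
      rw [if_neg (by omega), if_neg (by omega), zero_add]
    · have := a.2; have := b.1.2; have := b.2.2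
      rw [if_neg (by omega), if_neg (by omega), zero_add]
    · have := a.2; have := b.2
      rcases Nat.mod_two_eq_zero_or_one b with hb | hb
      · rw [add_comm]
        congr 1 <;> exact if_congr (by omega) rfl rfl
      · congr 1 <;> exact if_congr (by omega) rfl rfl
    · have := a.2; have := b.1.2; have := b.2.2
      rw [if_neg (by omega), if_neg (by omega), zero_add]
    · have := a.2; have := b.1.2; have := b.2.2
      rw [if_neg (by omega), if_neg (by omega), zero_add]
    · have := a.2; have := b.2
      rw [if_neg (by omega), if_neg (by omega), zero_add]
    · have := a.2; have := b.1.2; have := b.2.2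
      rw [if_neg (c := _ ∧ δ = 1) (by omega), add_zero]
      exact if_congr (by omega) rfl rfl
  · have e1 : ∀ (z : ℤ) (d : ℕ), d < 2 → ¬ (((r, (2 * (l' : ℕ) + δ) * 2 ^ j + (s' : ℕ)) : ℤ × ℕ) =
        (z, (2 * l + d) * 2 ^ j + s)) := by
      intro z d hd h
      rw [Prod.mk.injEq] at h
      obtain ⟨e1, e2⟩ := column_inj s'.2 s.2 h.2
      exact hls ⟨Fin.ext (by omega), Fin.ext e2.symm⟩
    rw [if_neg (e1 _ 0 (by omega)), if_neg (e1 _ 1 (by omega)), zero_add]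
    symm
    by_cases hl : l = l'
    · rw [Matrix.blockDiagonal'_apply_ne _ _ _ (fun h => hls ⟨hl, h⟩), mul_zero]
    · rw [Matrix.one_apply_ne hl, zero_mul]

/-! ### The inverse of a level -/

theorem sqrt_two_mul_doubling (s : ℕ) :
    (Matrix.of fun (a : Fin s × Fin 2) b => if a.1 = b then (1 : ℝ) else 0) = √2 • doubling s := by
  ext a b
  simp [doubling]

theorem doubling_transpose_mul (s : ℕ) : (doubling s)ᵀ * doubling s = 1 := by
  ext a b
  rw [Matrix.mul_apply, Fintype.sum_prod_type]
  simp only [doubling, Matrix.transpose_apply, Matrix.of_apply, Fin.sum_univ_two]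
  rw [Finset.sum_eq_single a]
  · rw [Matrix.one_apply]
    simp only [if_true]
    split_ifs with h
    · have : √2 * √2 = 2 := Real.mul_self_sqrt (by norm_num)
      field_simp
      nlinarith
    · simp
  · intro c _ hc
    simp [hc]
  · intro h
    exact absurd (Finset.mem_univ a) h

/-- The pseudo-inverse `V Σ⁻¹ Uᵀ` of one block. -/
noncomputable def blockPinv (n s : ℕ) : Matrix (BlockCol n s) (BlockRow n s) ℝ :=
  Matrix.fromBlocks ((√2)⁻¹ • (doubling s)ᵀ) 0 0
    (Matrix.fromBlocks (convPinv (2 * 2 ^ n)) 0 0 ((√2)⁻¹ • (doubling s)ᵀ))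

/-- The inverses of the singular values of one block. -/
noncomputable def blockSigmaInv (n s : ℕ) : BlockCol n s → ℝ :=
  Sum.elim (fun _ => (√2)⁻¹) (Sum.elim (fun k => (convSigma (2 * 2 ^ n) k)⁻¹) (fun _ => (√2)⁻¹))

theorem blockPinv_eq (n s : ℕ) :
    blockV n s * Matrix.diagonal (blockSigmaInv n s) * (blockU n s)ᵀ = blockPinv n s := by
  have h : Matrix.diagonal (blockSigmaInv n s) = Matrix.fromBlocks ((√2)⁻¹ • 1) 0 0
      (Matrix.fromBlocks (Matrix.diagonal fun k => (convSigma (2 * 2 ^ n) k)⁻¹) 0 0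
        ((√2)⁻¹ • 1)) := by
    simp only [Matrix.smul_one_eq_diagonal, Matrix.fromBlocks_diagonal]
    rfl
  rw [h, blockV, blockU, blockPinv]
  simp only [Matrix.fromBlocks_transpose, Matrix.fromBlocks_multiply, Matrix.transpose_zero,
    Matrix.mul_zero, Matrix.zero_mul, add_zero, zero_add, Matrix.one_mul, Matrix.smul_mul, convPinv]

theorem blockPinv_mul_blockK (n s : ℕ) : blockPinv n s * blockK n s = 1 := by
  have h2 : (√2)⁻¹ * √2 = 1 := inv_mul_cancel₀ (by positivity)
  rw [blockPinv, blockK, sqrt_two_mul_doubling]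
  simp only [Matrix.fromBlocks_multiply, Matrix.mul_zero, Matrix.zero_mul, add_zero, zero_add,
    Matrix.smul_mul, Matrix.mul_smul, doubling_transpose_mul, convPinv_mul_convK, smul_smul,
    mul_comm (√2), h2, one_smul, smul_zero, Matrix.fromBlocks_one]

theorem levelSigma_inv (n j : ℕ) : (levelSigma n j)⁻¹ =
    (1 : Matrix (Fin 4) (Fin 4) ℝ) ⊗ₖ
      ((1 : Matrix (Fin (2 ^ (n - (j + 1)))) (Fin (2 ^ (n - (j + 1)))) ℝ) ⊗ₖ
        Matrix.blockDiagonal' (fun s : Fin (2 ^ j) => Matrix.diagonal (blockSigmaInv n s))) := by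
  apply Matrix.inv_eq_right_inv
  rw [levelSigma, ← Matrix.mul_kronecker_mul, ← Matrix.mul_kronecker_mul,
    ← Matrix.blockDiagonal'_mul]
  have : ∀ s : Fin (2 ^ j), blockSigma n s * Matrix.diagonal (blockSigmaInv n s) = 1 := by
    intro s
    rw [blockSigma, Matrix.diagonal_mul_diagonal, ← Matrix.diagonal_one]
    congr 1
    ext x
    rcases x with a | k | a
    · simp [blockSigmaInv]
    · simpa [blockSigmaInv] using mul_inv_cancel₀ (convSigma_pos (2 * 2 ^ n) k).ne'
    · simp [blockSigmaInv]
  simp only [this, Matrix.one_mul]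
  have h1 : Matrix.blockDiagonal' (fun s : Fin (2 ^ j) => (1 : Matrix (BlockCol n s) _ ℝ)) = 1 :=
    Matrix.blockDiagonal'_one
  rw [h1, Matrix.one_kronecker_one, Matrix.one_kronecker_one]

/-- The inverse `V Σ⁻¹ Uᵀ` of a level in a single quadrant. -/
noncomputable def levelPinv (n j : ℕ) : Matrix (E n j) (E n (j + 1)) ℝ :=
  (flatten n j)ᵀ * ((1 : Matrix (Fin (2 ^ (n - (j + 1)))) (Fin (2 ^ (n - (j + 1)))) ℝ) ⊗ₖ
    Matrix.blockDiagonal' (fun s : Fin (2 ^ j) => blockPinv n s)) * (unflatten n j)ᵀ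

theorem levelV_mul_inv_mul_levelU (n j : ℕ) :
    levelV n j * (levelSigma n j)⁻¹ * (levelU n j)ᵀ =
      (1 : Matrix (Fin 4) (Fin 4) ℝ) ⊗ₖ levelPinv n j := by
  rw [levelSigma_inv, levelV, levelU, ← Matrix.kroneckerMap_transpose, ← Matrix.mul_kronecker_mul,
    ← Matrix.mul_kronecker_mul, levelPinv, Matrix.transpose_mul, ← Matrix.kroneckerMap_transpose,
    Matrix.blockDiagonal'_transpose]
  simp only [Matrix.transpose_one, Matrix.one_mul, ← blockPinv_eq]
  congr 1
  rw [Matrix.blockDiagonal'_mul, Matrix.blockDiagonal'_mul]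
  simp only [← Matrix.mul_assoc]
  congr 1
  simp only [Matrix.mul_assoc, ← Matrix.mul_kronecker_mul, Matrix.one_mul]

theorem levelPinv_mul_level {n j : ℕ} (hj : j + 1 ≤ n) : levelPinv n j * level n j = 1 := by
  have h : (unflatten n j)ᵀ * level n j =
      ((1 : Matrix (Fin (2 ^ (n - (j + 1)))) (Fin (2 ^ (n - (j + 1)))) ℝ) ⊗ₖ
        Matrix.blockDiagonal' (fun s : Fin (2 ^ j) => blockK n s)) * flatten n j := by
    rw [← unflatten_level_flatten hj, Matrix.mul_assoc, flatten_transpose_mul_flatten hj,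
      Matrix.mul_one]
  rw [levelPinv, Matrix.mul_assoc, h, Matrix.mul_assoc, ← Matrix.mul_assoc (_ ⊗ₖ _),
    ← Matrix.mul_kronecker_mul, ← Matrix.blockDiagonal'_mul]
  simp only [blockPinv_mul_blockK, Matrix.one_mul]
  have h1 : Matrix.blockDiagonal' (fun s : Fin (2 ^ j) => (1 : Matrix (BlockCol n s) _ ℝ)) = 1 :=
    Matrix.blockDiagonal'_one
  rw [h1, Matrix.one_kronecker_one, Matrix.one_mul, flatten_transpose_mul_flatten hj]

theorem levelPinv_mulVec_apply {n j : ℕ} (hj : j + 1 ≤ n) (b : E n (j + 1) → ℝ)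
    {e : E n j} {x : FlatCol n j} (h : e.1 = colCell n j x.1 x.2.1 x.2.2) :
    (levelPinv n j *ᵥ b) e = (blockPinv n x.2.1 *ᵥ fun y =>
      b ⟨rowCell n j x.1 x.2.1 y, rowCell_mem hj ⟨x.1, x.2.1, y⟩⟩) x.2.2 := by
  obtain ⟨l, s, x⟩ := x
  have h0 : ∀ y, ((unflatten n j)ᵀ *ᵥ b) y =
      b ⟨rowCell n j y.1 y.2.1 y.2.2, rowCell_mem hj y⟩ := by
    intro y
    have := unflatten_transpose_mul_apply hj (Matrix.replicateCol Unit b) y ()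
    simpa [Matrix.mul_apply, Matrix.mulVec, dotProduct] using this
  rw [levelPinv, ← Matrix.mulVec_mulVec]
  simp only [Matrix.mulVec, dotProduct]
  simp only [flatten_transpose_mul_apply _ h]
  rw [Fintype.sum_prod_type, Finset.sum_eq_single l]
  · rw [Fintype.sum_sigma, Finset.sum_eq_single s]
    · refine Finset.sum_congr rfl fun y _ => ?_
      rw [Matrix.kroneckerMap_apply, Matrix.one_apply_eq, one_mul, Matrix.blockDiagonal'_apply_eq]
      congr 1
      exact h0 ⟨l, s, y⟩
    · intro s' _ hs
      refine Finset.sum_eq_zero fun y _ => ?_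
      rw [Matrix.kroneckerMap_apply, Matrix.blockDiagonal'_apply_ne _ _ _ (Ne.symm hs), mul_zero,
        zero_mul]
    · simp
  · intro l' _ hl
    refine Finset.sum_eq_zero fun y _ => ?_
    rw [Matrix.kroneckerMap_apply, Matrix.one_apply_ne (Ne.symm hl), zero_mul, zero_mul]
  · simp

/-! ### The cross-quadrant level -/

theorem two_pow_eq {n : ℕ} (hn : 1 ≤ n) : 2 ^ n = 2 * 2 ^ (n - 1) := by
  rw [← pow_succ']; congr 1; omega

theorem phi_eq_convV {n : ℕ} (hn : 1 ≤ n) (k₁ k₂ j₁ j₂ : Fin (2 ^ (n - 1))) :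
    phi n k₁ k₂ (j₁ : ℕ) (j₂ : ℕ) =
      convV (2 ^ (n - 1)) j₁ k₁ * convV (2 ^ (n - 1)) j₂ k₂ := by
  have h2 : (2 : ℝ) ^ n = 2 * 2 ^ (n - 1) := by exact_mod_cast two_pow_eq hn
  have h3 : (2 : ℝ) ^ n / 2 = 2 ^ (n - 1) := by rw [h2]; ring
  have hsq : √(2 / ((2 : ℝ) ^ (n - 1) + 1)) * √(2 / ((2 : ℝ) ^ (n - 1) + 1)) =
      4 / ((2 : ℝ) ^ n + 2) := by
    rw [Real.mul_self_sqrt (by positivity), h2]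
    field_simp
    ring
  simp only [phi, convV, angle, Matrix.of_apply, h3, ← hsq]
  push_cast
  ring

/-- Orthonormality of the two-dimensional sinusoids, in the form of a completeness relation. -/
theorem sum_phi_mul_phi {n : ℕ} (hn : 1 ≤ n) (j₁ j₂ j₁' j₂' : Fin (2 ^ (n - 1))) :
    ∑ k : Fin (2 ^ (n - 1)) × Fin (2 ^ (n - 1)), phi n k.1 k.2 (j₁ : ℕ) (j₂ : ℕ) *
      phi n k.1 k.2 (j₁' : ℕ) (j₂' : ℕ) = if j₁ = j₁' ∧ j₂ = j₂' then 1 else 0 := by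
  have h : ∀ a b : Fin (2 ^ (n - 1)), ∑ k, convV (2 ^ (n - 1)) a k * convV (2 ^ (n - 1)) b k =
      if a = b then 1 else 0 := by
    intro a b
    have := congrFun (congrFun (convV_mul_transpose (2 ^ (n - 1))) a) b
    rwa [Matrix.mul_apply, Matrix.one_apply] at this
  simp only [phi_eq_convV hn]
  rw [Fintype.sum_prod_type, ite_and]
  calc _ = (∑ k, convV (2 ^ (n - 1)) j₁ k * convV (2 ^ (n - 1)) j₁' k) *
        ∑ k, convV (2 ^ (n - 1)) j₂ k * convV (2 ^ (n - 1)) j₂' k := by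
          rw [Finset.sum_mul_sum]
          exact Finset.sum_congr rfl fun k _ => Finset.sum_congr rfl fun k' _ => by ring
    _ = _ := by rw [h, h]; split_ifs <;> simp

theorem crossV_apply {n : ℕ} (hn : 1 ≤ n) (i : Img n) (c : Spec n) :
    crossV n i c = 1 / √2 * (phi n c.2.1 c.2.2 ((i.1 : ℕ) / 2 : ℕ) ((i.2 : ℕ) / 2 : ℕ) *
      pattern c.1 (Fin.ofNat 2 (i.1 : ℕ)) (Fin.ofNat 2 (i.2 : ℕ))) := by
  have h2 := two_pow_eq hn
  have h1 := i.1.2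
  have h3 := i.2.2
  simp only [crossV, Matrix.of_apply, chi]
  congr 1
  rw [Finset.sum_eq_single ⟨(i.1 : ℕ) / 2, by omega⟩,
    Finset.sum_eq_single ⟨(i.2 : ℕ) / 2, by omega⟩]
  · simp
  · intro j _ hj
    rw [if_neg, mul_zero]
    exact fun h => hj (Fin.ext h.2.symm)
  · simp
  · intro j _ hj
    refine Finset.sum_eq_zero fun j' _ => ?_
    rw [if_neg, mul_zero]
    exact fun h => hj (Fin.ext h.1.symm)
  · simp

theorem ofNat_two_eq (m : ℕ) : Fin.ofNat 2 m = if m % 2 = 0 then 0 else 1 := by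
  rcases Nat.mod_two_eq_zero_or_one m with h | h
  · rw [if_pos h]; exact Fin.ext (by simpa using h)
  · rw [if_neg (by omega)]; exact Fin.ext (by simpa using h)

/-- A row of a matrix with columns `(p, k₁, k₂)` that belongs to a single `2 × 2` block: it depends
on the frequencies only through the values of the sinusoids at that block. -/
def LocalAt {R : Type} {n : ℕ} (Y : Matrix R (Spec n) ℝ) (r : R) (j₁ j₂ : ℤ) : Prop :=
  ∃ α : Fin 4 → ℝ, ∀ c : Spec n, Y r c = α c.1 * phi n c.2.1 c.2.2 j₁ j₂

theorem LocalAt.mul_kronecker {R : Type} {n : ℕ} {Y : Matrix R (Spec n) ℝ} {r : R} {j₁ j₂ : ℤ}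
    (h : LocalAt Y r j₁ j₂) (A : Matrix (Fin 4) (Fin 4) ℝ) :
    LocalAt (Y * (A ⊗ₖ (1 : Matrix (Fin (2 ^ (n - 1)) × Fin (2 ^ (n - 1)))
      (Fin (2 ^ (n - 1)) × Fin (2 ^ (n - 1))) ℝ))) r j₁ j₂ := by
  obtain ⟨α, hα⟩ := h
  refine ⟨fun p => ∑ p', α p' * A p' p, fun c => ?_⟩
  rw [Matrix.mul_apply, Fintype.sum_prod_type, Finset.sum_mul]
  refine Finset.sum_congr rfl fun p' _ => ?_
  rw [Finset.sum_eq_single c.2]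
  · rw [hα, Matrix.kroneckerMap_apply, Matrix.one_apply_eq]
    ring
  · intro k _ hk
    rw [Matrix.kroneckerMap_apply, Matrix.one_apply_ne hk, mul_zero, mul_zero]
  · simp

/-- The sinusoids of two different blocks are orthogonal. -/
theorem LocalAt.mul_transpose_eq_zero {R R' : Type} {n : ℕ} (hn : 1 ≤ n)
    {Y : Matrix R (Spec n) ℝ} {Y' : Matrix R' (Spec n) ℝ} {r : R} {r' : R'}
    {j₁ j₂ j₁' j₂' : Fin (2 ^ (n - 1))} (h : LocalAt Y r (j₁ : ℕ) (j₂ : ℕ))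
    (h' : LocalAt Y' r' (j₁' : ℕ) (j₂' : ℕ)) (hne : ¬ (j₁ = j₁' ∧ j₂ = j₂')) :
    (Y * Y'ᵀ) r r' = 0 := by
  obtain ⟨α, hα⟩ := h
  obtain ⟨β, hβ⟩ := h'
  rw [Matrix.mul_apply, Fintype.sum_prod_type]
  refine Finset.sum_eq_zero fun p _ => ?_
  have := sum_phi_mul_phi hn j₁ j₂ j₁' j₂'
  rw [if_neg hne] at this
  calc _ = (α p * β p) * ∑ k : Fin (2 ^ (n - 1)) × Fin (2 ^ (n - 1)),
        phi n k.1 k.2 (j₁ : ℕ) (j₂ : ℕ) * phi n k.1 k.2 (j₁' : ℕ) (j₂' : ℕ) := by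
        rw [Finset.mul_sum]
        refine Finset.sum_congr rfl fun k _ => ?_
        rw [Matrix.transpose_apply, hα, hβ]
        ring
    _ = 0 := by rw [this, mul_zero]

theorem crossV_mul_transpose {n : ℕ} (hn : 1 ≤ n) : crossV n * (crossV n)ᵀ = 1 := by
  have h2 := two_pow_eq hn
  ext i i'
  have h11 := i.1.2
  have h12 := i.2.2
  have h21 := i'.1.2
  have h22 := i'.2.2
  have hs : (1 / √2) * (1 / √2) = 1 / 2 := by
    rw [div_mul_div_comm, Real.mul_self_sqrt (by norm_num)]; norm_num
  have key : (crossV n * (crossV n)ᵀ) i i' = 1 / 2 * (∑ p,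
      pattern p (Fin.ofNat 2 (i.1 : ℕ)) (Fin.ofNat 2 (i.2 : ℕ)) *
      pattern p (Fin.ofNat 2 (i'.1 : ℕ)) (Fin.ofNat 2 (i'.2 : ℕ))) *
      (if (i.1 : ℕ) / 2 = (i'.1 : ℕ) / 2 ∧ (i.2 : ℕ) / 2 = (i'.2 : ℕ) / 2 then 1 else 0) := by
    have hphi := sum_phi_mul_phi hn ⟨(i.1 : ℕ) / 2, by omega⟩ ⟨(i.2 : ℕ) / 2, by omega⟩
      ⟨(i'.1 : ℕ) / 2, by omega⟩ ⟨(i'.2 : ℕ) / 2, by omega⟩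
    simp only [Fin.mk.injEq] at hphi
    rw [← hphi, Matrix.mul_apply, Fintype.sum_prod_type, mul_assoc, Finset.sum_mul_sum,
      Finset.mul_sum]
    refine Finset.sum_congr rfl fun p _ => ?_
    rw [Finset.mul_sum]
    refine Finset.sum_congr rfl fun k _ => ?_
    rw [Matrix.transpose_apply, crossV_apply hn, crossV_apply hn, ← hs]
    ring
  rw [key]
  by_cases hb : (i.1 : ℕ) / 2 = (i'.1 : ℕ) / 2 ∧ (i.2 : ℕ) / 2 = (i'.2 : ℕ) / 2
  · rw [if_pos hb, mul_one, Matrix.one_apply]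
    have hi : i = i' ↔ (i.1 : ℕ) % 2 = (i'.1 : ℕ) % 2 ∧ (i.2 : ℕ) % 2 = (i'.2 : ℕ) % 2 := by
      rw [Prod.ext_iff, Fin.ext_iff, Fin.ext_iff]
      omega
    simp only [hi, ofNat_two_eq, Fin.sum_univ_four, pattern]
    rcases Nat.mod_two_eq_zero_or_one i.1 with e1 | e1 <;>
    rcases Nat.mod_two_eq_zero_or_one i.2 with e2 | e2 <;>
    rcases Nat.mod_two_eq_zero_or_one i'.1 with e3 | e3 <;>
    rcases Nat.mod_two_eq_zero_or_one i'.2 with e4 | e4 <;>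
    simp [e1, e2, e3, e4] <;> norm_num
  · rw [if_neg hb, mul_zero, Matrix.one_apply_ne]
    rintro rfl
    exact hb ⟨rfl, rfl⟩

/-! ### The truncated cross-quadrant level acts blockwise -/

/-- The cell of quadrant `q` at which the pixel `i` is read, inverse to `source`. -/
def target (n : ℕ) (q : Fin 4) (i : Img n) : ℤ × ℕ :=
  match q with
  | 0 => (2 ^ n - 1 - ((i.2 : ℕ) : ℤ), i.1)
  | 1 => (2 ^ n - 1 - ((i.1 : ℕ) : ℤ), i.2)
  | 2 => ((i.1 : ℕ), i.2)
  | 3 => (2 ^ n - 1 - ((i.2 : ℕ) : ℤ), 2 ^ n - 1 - i.1)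

theorem target_bounds (n : ℕ) (q : Fin 4) (i : Img n) :
    0 ≤ (target n q i).1 ∧ (target n q i).1 < 2 ^ n ∧ (target n q i).2 < 2 ^ n := by
  have h1 := i.1.2
  have h2 := i.2.2
  have h3 : ((2 ^ n : ℕ) : ℤ) = (2 : ℤ) ^ n := by push_cast; rfl
  fin_cases q <;> simp only [target] <;> omega

theorem target_mem (n : ℕ) (q : Fin 4) (i : Img n) : target n q i ∈ E n 0 := by
  obtain ⟨h1, h2, h3⟩ := target_bounds n q i
  show ((target n q i).1, (target n q i).2) ∈ _
  rw [mem_E (Nat.zero_le n)]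
  omega

theorem eq_source_iff {n : ℕ} {q : Fin 4} {i : Img n} {e : ℤ × ℕ} (he : e ∈ E n 0) :
    ((i.1 : ℤ), (i.2 : ℤ)) = source n q e.1 e.2 ↔ e = target n q i := by
  obtain ⟨h, s⟩ := e
  rw [mem_E (Nat.zero_le n)] at he
  have h1 := i.1.2
  have h2 := i.2.2
  have h3 : ((2 ^ n : ℕ) : ℤ) = (2 : ℤ) ^ n := by push_cast; rfl
  fin_cases q <;> simp only [target, source, Prod.mk.injEq] <;> omega

theorem crossLevel_apply (n : ℕ) (q : Fin 4) (e : E n 1) (i : Img n) :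
    crossLevel n (q, e) i = level n 0 e ⟨target n q i, target_mem n q i⟩ := by
  simp only [crossLevel, Matrix.of_apply]
  rw [Matrix.mul_apply, Finset.sum_eq_single ⟨target n q i, target_mem n q i⟩]
  · rw [quadrant, Matrix.of_apply, if_pos ((eq_source_iff (target_mem n q i)).2 rfl), mul_one]
  · intro f _ hf
    rw [quadrant, Matrix.of_apply, if_neg, mul_zero]
    exact fun h => hf (Subtype.ext ((eq_source_iff f.2).1 h))
  · simp

theorem sum_ite_cell_eq {n m : ℕ} {z : ℤ × ℕ} (hz : z ∈ E n m) (X : ℤ × ℕ → ℝ) :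
    ∑ e : E n m, (if e.1 = z then 1 else 0) * X e.1 = X z := by
  rw [Finset.sum_eq_single ⟨z, hz⟩]
  · simp
  · intro e _ he
    rw [if_neg (fun h => he (Subtype.ext h)), zero_mul]
  · simp

/-- The adjoint of the first level: each pixel contributes to two cells. -/
theorem sum_level_zero_mul {n : ℕ} (hn : 1 ≤ n) (f : E n 0) (X : ℤ × ℕ → ℝ) :
    ∑ e : E n 1, level n 0 e f * X e.1 =
      if f.1.2 % 2 = 0 then X f.1 + X (f.1.1, f.1.2 + 1)
      else X (f.1.1, f.1.2 - 1) + X (f.1.1 - 1, f.1.2) := by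
  obtain ⟨⟨a, b⟩, hf⟩ := f
  have hf' := hf
  rw [mem_E (Nat.zero_le n)] at hf'
  have h2 := two_pow_eq hn
  have key : ∀ z z' : ℤ × ℕ, z ∈ E n 1 → z' ∈ E n 1 →
      (∀ e : E n 1, level n 0 e ⟨(a, b), hf⟩ =
        (if e.1 = z then 1 else 0) + (if e.1 = z' then 1 else 0)) →
      ∑ e : E n 1, level n 0 e ⟨(a, b), hf⟩ * X e.1 = X z + X z' := by
    intro z z' hz hz' h
    simp only [h, add_mul, Finset.sum_add_distrib, sum_ite_cell_eq hz, sum_ite_cell_eq hz']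
  dsimp only
  split_ifs with hb
  · refine key _ _ ((mem_E hn).2 (by omega)) ((mem_E hn).2 (by omega)) fun e => ?_
    obtain ⟨⟨h, s⟩, he⟩ := e
    simp only [level, Matrix.of_apply, Prod.mk.injEq, zero_add, pow_one, pow_zero, mul_one]
    rcases Nat.mod_two_eq_zero_or_one s with hs | hs
    · congr 1 <;> exact if_congr (by omega) rfl rfl
    · rw [add_comm]
      congr 1 <;> exact if_congr (by omega) rfl rfl
  · refine key _ _ ((mem_E hn).2 (by omega)) ((mem_E hn).2 (by omega)) fun e => ?_
    obtain ⟨⟨h, s⟩, he⟩ := e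
    simp only [level, Matrix.of_apply, Prod.mk.injEq, zero_add, pow_one, pow_zero, mul_one]
    rcases Nat.mod_two_eq_zero_or_one s with hs | hs
    · rw [add_comm]
      congr 1 <;> exact if_congr (by omega) rfl rfl
    · congr 1 <;> exact if_congr (by omega) rfl rfl

/-- The cell values of `w` in quadrant `q`, with the cells shared by two blocks deleted. -/
noncomputable def truncW (n : ℕ) (c : Spec n) (q : Fin 4) (e : ℤ × ℕ) : ℝ :=
  if e.1 % 2 = 1 ∧ e.2 % 2 = 1 then 0 else crossW n c q e.1 (e.2 : ℕ)

theorem crossSigmaVal_pos (n : ℕ) (c : Spec n) : 0 < crossSigmaVal n c := by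
  rw [crossSigmaVal]
  split_ifs <;> positivity

theorem trunc_mul_crossU_mul_crossSigma_apply (n : ℕ) (r : Fin 4 × E n 1) (c : Spec n) :
    (trunc n * crossU n * crossSigma n) r c = truncW n c r.1 r.2.1 := by
  rw [crossSigma, Matrix.mul_diagonal, trunc, Matrix.diagonal_mul, truncW]
  split_ifs
  · simp
  · rw [one_mul, crossU, Matrix.of_apply, div_mul_cancel₀ _ (crossSigmaVal_pos n c).ne']

theorem truncW_eq (n : ℕ) (c : Spec n) (q : Fin 4) (h : ℤ) (s : ℕ) :
    truncW n c q (h, s) = 1 / √2 *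
      (phi n c.2.1 c.2.2 ((source n q h s).1 / 2) ((source n q h s).2 / 2) *
      (if s % 2 = 0 then (if h % 2 = 0 then coeffEvenEven c.1 q else coeffOddEven c.1 q)
        else (if h % 2 = 0 then coeffEvenOdd c.1 q else 0))) := by
  rw [truncW, crossW]
  dsimp only
  rcases Nat.mod_two_eq_zero_or_one s with hs | hs <;>
    rcases Int.emod_two_eq_zero_or_one h with hh | hh
  · rw [if_neg (by omega), if_pos (by omega), if_pos hh, if_pos hs, if_pos hh]; ring
  · rw [if_neg (by omega), if_pos (by omega), if_neg (by omega), if_pos hs, if_neg (by omega)]; ring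
  · rw [if_neg (by omega), if_neg (by omega), if_pos hh, if_neg (by omega), if_pos hh]; ring
  · rw [if_pos ⟨hh, hs⟩, if_neg (by omega), if_neg (by omega)]; ring

theorem sum_crossLevel_mul_truncW {n : ℕ} (hn : 1 ≤ n) (q : Fin 4) (i : Img n) (c : Spec n) :
    ∑ e : E n 1, crossLevel n (q, e) i * truncW n c q e.1 = 1 / √2 *
      (phi n c.2.1 c.2.2 ((i.1 : ℕ) / 2 : ℕ) ((i.2 : ℕ) / 2 : ℕ) *
      ((if (target n q i).1 % 2 = 0 then coeffEvenEven c.1 q else coeffOddEven c.1 q) +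
        (if (target n q i).1 % 2 = ((target n q i).2 : ℤ) % 2 then coeffEvenOdd c.1 q else 0))) := by
  simp only [crossLevel_apply]
  rw [sum_level_zero_mul hn]
  show (if (target n q i).2 % 2 = 0 then truncW n c q ((target n q i).1, (target n q i).2) +
    truncW n c q ((target n q i).1, (target n q i).2 + 1) else
    truncW n c q ((target n q i).1, (target n q i).2 - 1) +
    truncW n c q ((target n q i).1 - 1, (target n q i).2)) = _
  have hblock : ∀ (h : ℤ) (s : ℕ), h / 2 = (target n q i).1 / 2 → s / 2 = (target n q i).2 / 2 →
      (source n q h s).1 / 2 = ((i.1 : ℕ) / 2 : ℕ) ∧ (source n q h s).2 / 2 = ((i.2 : ℕ) / 2 : ℕ) := by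
    have h1 := i.1.2
    have h2 := i.2.2
    have h3 : ((2 ^ n : ℕ) : ℤ) = (2 : ℤ) ^ n := by push_cast; rfl
    have h4 := two_pow_eq hn
    intro h s
    fin_cases q <;> simp only [target, source] <;> omega
  generalize (target n q i).1 = a at hblock
  generalize (target n q i).2 = b at hblock
  rcases Nat.mod_two_eq_zero_or_one b with hb | hb <;>
    rcases Int.emod_two_eq_zero_or_one a with ha | ha
  · rw [if_pos hb, truncW_eq, truncW_eq, (hblock a b rfl rfl).1, (hblock a b rfl rfl).2,
      (hblock a (b + 1) rfl (by omega)).1, (hblock a (b + 1) rfl (by omega)).2, if_pos hb,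
      if_pos ha, if_neg (by omega), if_pos ha, if_pos (by omega)]
    ring
  · rw [if_pos hb, truncW_eq, truncW_eq, (hblock a b rfl rfl).1, (hblock a b rfl rfl).2,
      (hblock a (b + 1) rfl (by omega)).1, (hblock a (b + 1) rfl (by omega)).2, if_pos hb,
      if_neg (by omega), if_neg (by omega), if_neg (by omega), if_neg (by omega)]
    ring
  · rw [if_neg (by omega), truncW_eq, truncW_eq, (hblock a (b - 1) rfl (by omega)).1,
      (hblock a (b - 1) rfl (by omega)).2, if_pos (by omega), if_pos ha, if_neg (by omega),
      if_neg (by omega), if_neg (by omega)]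
    ring
  · rw [if_neg (by omega), truncW_eq, truncW_eq, (hblock a (b - 1) rfl (by omega)).1,
      (hblock a (b - 1) rfl (by omega)).2, (hblock (a - 1) b (by omega) rfl).1,
      (hblock (a - 1) b (by omega) rfl).2, if_pos (by omega), if_neg (by omega), if_neg (by omega),
      if_pos (by omega), if_pos (by omega)]
    ring

/-- The Gram matrix of the truncated cross-quadrant level in the basis of the four patterns. -/
noncomputable def gram : Matrix (Fin 4) (Fin 4) ℝ := !![8, 0, 4, 0; 0, 4, 0, 0; 4, 0, 8, 0; 0, 0, 0, 4]

theorem crossLevel_transpose_mul {n : ℕ} (hn : 1 ≤ n) :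
    (crossLevel n)ᵀ * (trunc n * crossU n * crossSigma n) =
      crossV n * (gram ⊗ₖ (1 : Matrix (Fin (2 ^ (n - 1)) × Fin (2 ^ (n - 1)))
        (Fin (2 ^ (n - 1)) × Fin (2 ^ (n - 1))) ℝ)) := by
  ext i ⟨p, k⟩
  have hR : (crossV n * (gram ⊗ₖ (1 : Matrix (Fin (2 ^ (n - 1)) × Fin (2 ^ (n - 1)))
        (Fin (2 ^ (n - 1)) × Fin (2 ^ (n - 1))) ℝ))) i (p, k) = 1 / √2 *
      (phi n k.1 k.2 ((i.1 : ℕ) / 2 : ℕ) ((i.2 : ℕ) / 2 : ℕ) * ∑ p',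
        pattern p' (Fin.ofNat 2 (i.1 : ℕ)) (Fin.ofNat 2 (i.2 : ℕ)) * gram p' p) := by
    rw [Matrix.mul_apply, Fintype.sum_prod_type, Finset.mul_sum, Finset.mul_sum]
    refine Finset.sum_congr rfl fun p' _ => ?_
    rw [Finset.sum_eq_single k]
    · rw [crossV_apply hn, Matrix.kroneckerMap_apply, Matrix.one_apply_eq]
      ring
    · intro k' _ hk
      rw [Matrix.kroneckerMap_apply, Matrix.one_apply_ne hk, mul_zero, mul_zero]
    · simp
  rw [hR, Matrix.mul_apply, Fintype.sum_prod_type]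
  simp only [Matrix.transpose_apply, trunc_mul_crossU_mul_crossSigma_apply,
    sum_crossLevel_mul_truncW hn]
  rw [← Finset.mul_sum, ← Finset.mul_sum]
  congr 2
  have h1 := i.1.2
  have h2 := i.2.2
  have h3 : ((2 ^ n : ℕ) : ℤ) = (2 : ℤ) ^ n := by push_cast; rfl
  have h4 := two_pow_eq hn
  have t0 : (target n 0 i).1 % 2 = 1 - ((i.2 % 2 : ℕ) : ℤ) ∧
      ((target n 0 i).2 : ℤ) % 2 = ((i.1 % 2 : ℕ) : ℤ) := by simp only [target]; omega
  have t1 : (target n 1 i).1 % 2 = 1 - ((i.1 % 2 : ℕ) : ℤ) ∧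
      ((target n 1 i).2 : ℤ) % 2 = ((i.2 % 2 : ℕ) : ℤ) := by simp only [target]; omega
  have t2 : (target n 2 i).1 % 2 = ((i.1 % 2 : ℕ) : ℤ) ∧
      ((target n 2 i).2 : ℤ) % 2 = ((i.2 % 2 : ℕ) : ℤ) := by simp only [target]; omega
  have t3 : (target n 3 i).1 % 2 = 1 - ((i.2 % 2 : ℕ) : ℤ) ∧
      ((target n 3 i).2 : ℤ) % 2 = 1 - ((i.1 % 2 : ℕ) : ℤ) := by simp only [target]; omega
  simp only [Fin.sum_univ_four, ofNat_two_eq, t0, t1, t2, t3]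
  rcases Nat.mod_two_eq_zero_or_one i.1 with e1 | e1 <;>
    rcases Nat.mod_two_eq_zero_or_one i.2 with e2 | e2 <;> simp only [e1, e2] <;> fin_cases p <;>
    simp [coeffEvenEven, coeffOddEven, coeffEvenOdd, pattern, gram] <;> norm_num

/-! ### The explicit inverse of the cross-quadrant level -/

/-- The action of `mix` on the four types. -/
noncomputable def mixType : Matrix (Fin 4) (Fin 4) ℝ :=
  !![1 / √2, 0, 1 / √2, 0; 0, 1, 0, 0; 1 / √2, 0, -(1 / √2), 0; 0, 0, 0, 1]

/-- The lengths in `scale`, which depend on the type only. -/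
noncomputable def scaleType (p : Fin 4) : ℝ := if p = 0 then 2 * √3 else 2

theorem scaleType_ne_zero (p : Fin 4) : scaleType p ≠ 0 := by
  rw [scaleType]; split_ifs <;> positivity

theorem mixType_mul_transpose : mixType * mixTypeᵀ = 1 := by
  have hs : (√2)⁻¹ * (√2)⁻¹ = 1 / 2 := by
    rw [← mul_inv, Real.mul_self_sqrt (by norm_num)]; norm_num
  ext p p'
  rw [Matrix.mul_apply, Fin.sum_univ_four]
  fin_cases p <;> fin_cases p' <;> simp [mixType, hs] <;> norm_num

theorem mixType_mul_diagonal_mul_transpose :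
    mixType * Matrix.diagonal (fun p => scaleType p * scaleType p) * mixTypeᵀ = gram := by
  have hs : (√2)⁻¹ * (√2)⁻¹ = 1 / 2 := by
    rw [← mul_inv, Real.mul_self_sqrt (by norm_num)]; norm_num
  have h3 : √3 * √3 = 3 := Real.mul_self_sqrt (by norm_num)
  have h0 : scaleType 0 * scaleType 0 = 12 := by
    simp only [scaleType, if_true]; linear_combination 4 * h3
  have h1 : ∀ p, p ≠ 0 → scaleType p * scaleType p = 4 := by
    intro p hp
    simp only [scaleType, if_neg hp]; norm_num
  ext p p'
  rw [Matrix.mul_apply, Fin.sum_univ_four]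
  simp only [Matrix.mul_diagonal, Matrix.transpose_apply, h0, h1 1 (by decide), h1 2 (by decide), h1 3 (by decide)]
  fin_cases p <;> fin_cases p' <;> simp [mixType, gram] <;> linarith

theorem scale_eq (n : ℕ) : scale n = Matrix.diagonal scaleType ⊗ₖ
    (1 : Matrix (Fin (2 ^ (n - 1)) × Fin (2 ^ (n - 1))) (Fin (2 ^ (n - 1)) × Fin (2 ^ (n - 1))) ℝ) := by
  rw [← Matrix.diagonal_one, Matrix.diagonal_kronecker_diagonal, scale]
  simp [scaleType]

theorem scale_inv (n : ℕ) : (scale n)⁻¹ = Matrix.diagonal (fun p => (scaleType p)⁻¹) ⊗ₖ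
    (1 : Matrix (Fin (2 ^ (n - 1)) × Fin (2 ^ (n - 1))) (Fin (2 ^ (n - 1)) × Fin (2 ^ (n - 1))) ℝ) := by
  apply Matrix.inv_eq_right_inv
  rw [scale_eq, ← Matrix.mul_kronecker_mul, Matrix.diagonal_mul_diagonal, Matrix.one_mul]
  simp only [mul_inv_cancel₀ (scaleType_ne_zero _), Matrix.diagonal_one, Matrix.one_kronecker_one]

theorem mix_mul_scale_inv (n : ℕ) : mix n * (scale n)⁻¹ =
    (mixType * Matrix.diagonal (fun p => (scaleType p)⁻¹)) ⊗ₖ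
    (1 : Matrix (Fin (2 ^ (n - 1)) × Fin (2 ^ (n - 1))) (Fin (2 ^ (n - 1)) × Fin (2 ^ (n - 1))) ℝ) := by
  rw [scale_inv]
  change mixType ⊗ₖ _ * _ = _
  rw [← Matrix.mul_kronecker_mul, Matrix.one_mul]

/-- `Q D⁻² Qᵀ` is the inverse of the Gram matrix `Q D² Qᵀ`. -/
theorem mixType_inverse :
    mixType * Matrix.diagonal (fun p => (scaleType p)⁻¹) *
      (mixType * Matrix.diagonal (fun p => (scaleType p)⁻¹))ᵀ * gramᵀ = 1 := by
  have h := mul_eq_one_comm.1 mixType_mul_transpose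
  rw [← mixType_mul_diagonal_mul_transpose]
  simp only [Matrix.transpose_mul, Matrix.transpose_transpose, Matrix.diagonal_transpose,
    Matrix.mul_assoc]
  rw [← Matrix.mul_assoc mixTypeᵀ, h, Matrix.one_mul, ← Matrix.mul_assoc (Matrix.diagonal _) (Matrix.diagonal _),
    Matrix.diagonal_mul_diagonal, ← Matrix.mul_assoc (Matrix.diagonal _) (Matrix.diagonal _),
    Matrix.diagonal_mul_diagonal]
  have : (fun p => (scaleType p)⁻¹ * (scaleType p)⁻¹ * (scaleType p * scaleType p)) = 1 := by
    ext p
    have := scaleType_ne_zero p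
    simp only [Pi.one_apply]
    field_simp
  simp only [funext_iff, Pi.one_apply] at this
  simp only [this, Matrix.diagonal_one, Matrix.one_mul, mixType_mul_transpose]

theorem crossVHat_mul_crossUHat_transpose_mul_crossLevel {n : ℕ} (hn : 1 ≤ n) :
    crossVHat n * (crossUHat n)ᵀ * crossLevel n = 1 := by
  have h := congrArg Matrix.transpose (crossLevel_transpose_mul hn)
  rw [Matrix.transpose_mul, Matrix.transpose_transpose, Matrix.transpose_mul (crossV n)] at h
  rw [crossVHat, crossUHat, Matrix.mul_assoc (crossV n), Matrix.mul_assoc (_ * crossSigma n),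
    mix_mul_scale_inv, Matrix.transpose_mul (_ * crossSigma n), Matrix.mul_assoc, Matrix.mul_assoc,
    Matrix.mul_assoc, h, ← Matrix.kroneckerMap_transpose, ← Matrix.kroneckerMap_transpose,
    Matrix.transpose_one, ← Matrix.mul_assoc (_ ⊗ₖ _) (_ ⊗ₖ _) (crossV n)ᵀ,
    ← Matrix.mul_assoc (_ ⊗ₖ _) (_ * _) (crossV n)ᵀ, ← Matrix.mul_kronecker_mul,
    ← Matrix.mul_kronecker_mul, Matrix.one_mul, Matrix.one_mul, ← Matrix.mul_assoc _ _ gramᵀ,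
    mixType_inverse, Matrix.one_kronecker_one, Matrix.one_mul, crossV_mul_transpose hn]

/-- The explicit inverse of the cross-quadrant level is sparse: it links a pixel only to those
undeleted cells that belong to its `2 × 2` block. -/
theorem crossVHat_mul_crossUHat_transpose_eq_zero {n : ℕ} (hn : 1 ≤ n) (i : Img n)
    (r : Fin 4 × E n 1)
    (h : ¬ (¬ (r.2.1.1 % 2 = 1 ∧ r.2.1.2 % 2 = 1) ∧
      (source n r.1 r.2.1.1 r.2.1.2).1 / 2 = ((i.1 : ℕ) / 2 : ℕ) ∧
      (source n r.1 r.2.1.1 r.2.1.2).2 / 2 = ((i.2 : ℕ) / 2 : ℕ))) :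
    (crossVHat n * (crossUHat n)ᵀ) i r = 0 := by
  have h2 := two_pow_eq hn
  have hi1 := i.1.2
  have hi2 := i.2.2
  have hV : LocalAt (crossVHat n) i ((i.1 : ℕ) / 2 : ℕ) ((i.2 : ℕ) / 2 : ℕ) := by
    rw [crossVHat, Matrix.mul_assoc, mix_mul_scale_inv]
    refine LocalAt.mul_kronecker ⟨fun p => 1 / √2 *
      pattern p (Fin.ofNat 2 (i.1 : ℕ)) (Fin.ofNat 2 (i.2 : ℕ)), fun c => ?_⟩ _
    rw [crossV_apply hn]
    ring
  obtain ⟨q, ⟨⟨a, b⟩, he⟩⟩ := r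
  dsimp only at h ⊢
  by_cases hm : a % 2 = 1 ∧ b % 2 = 1
  · rw [Matrix.mul_apply]
    refine Finset.sum_eq_zero fun c _ => ?_
    have : crossUHat n (q, ⟨(a, b), he⟩) c = 0 := by
      rw [crossUHat, Matrix.mul_assoc (_ * crossSigma n), Matrix.mul_apply]
      refine Finset.sum_eq_zero fun c' _ => ?_
      rw [trunc_mul_crossU_mul_crossSigma_apply, truncW, if_pos hm, zero_mul]
    rw [Matrix.transpose_apply, this, mul_zero]
  · have he' := he
    rw [mem_E hn] at he'
    have h3 : ((2 ^ n : ℕ) : ℤ) = (2 : ℤ) ^ n := by push_cast; rfl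
    have ha : 0 ≤ a := by omega
    have hsrc : 0 ≤ (source n q a b).1 ∧ (source n q a b).1 < 2 ^ n ∧
        0 ≤ (source n q a b).2 ∧ (source n q a b).2 < 2 ^ n := by
      fin_cases q <;> simp only [source] <;> omega
    have hU : LocalAt (crossUHat n) (q, ⟨(a, b), he⟩) ((source n q a b).1 / 2)
        ((source n q a b).2 / 2) := by
      rw [crossUHat, Matrix.mul_assoc (_ * crossSigma n), mix_mul_scale_inv]
      refine LocalAt.mul_kronecker ⟨fun p => 1 / √2 *
        (if b % 2 = 0 then (if a % 2 = 0 then coeffEvenEven p q else coeffOddEven p q)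
        else (if a % 2 = 0 then coeffEvenOdd p q else 0)), fun c => ?_⟩ _
      rw [trunc_mul_crossU_mul_crossSigma_apply, truncW_eq]
      ring
    obtain ⟨x, hx⟩ := Int.eq_ofNat_of_zero_le (a := (source n q a b).1 / 2) (by omega)
    obtain ⟨y, hy⟩ := Int.eq_ofNat_of_zero_le (a := (source n q a b).2 / 2) (by omega)
    rw [hx, hy] at hU
    refine LocalAt.mul_transpose_eq_zero hn (j₁ := ⟨(i.1 : ℕ) / 2, by omega⟩)
      (j₂ := ⟨(i.2 : ℕ) / 2, by omega⟩) (j₁' := ⟨x, by omega⟩) (j₂' := ⟨y, by omega⟩) hV hU ?_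
    simp only [Fin.mk.injEq]
    omega

theorem card_support_crossVHat_mul_crossUHat_transpose {n : ℕ} (hn : 1 ≤ n) (i : Img n) :
    (Finset.univ.filter fun r => (crossVHat n * (crossUHat n)ᵀ) i r ≠ 0).card ≤ 16 := by
  -- The quadrant and the parities of the cell determine it once the block is known.
  have hcard : ((Finset.univ : Finset (Fin 4)) ×ˢ (Finset.Ico (0 : ℤ) 2 ×ˢ Finset.range 2)).card =
      16 := by simp
  rw [← hcard]
  refine Finset.card_le_card_of_injOn (fun r => (r.1, r.2.1.1 % 2, r.2.1.2 % 2)) ?_ ?_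
  · intro r _
    refine Finset.mem_coe.2 (Finset.mem_product.2 ⟨Finset.mem_univ _, Finset.mem_product.2
      ⟨Finset.mem_Ico.2 ?_, Finset.mem_range.2 ?_⟩⟩) <;> dsimp only <;> omega
  · rintro ⟨q, ⟨⟨a, b⟩, he⟩⟩ h ⟨q', ⟨⟨a', b'⟩, he'⟩⟩ h' heq
    simp only [Finset.coe_filter, Finset.mem_univ, true_and, Set.mem_ofPred_eq] at h h'
    simp only [Prod.mk.injEq] at heq
    obtain ⟨rfl, h1, h2⟩ := heq
    have k := (not_imp_comm.1 (crossVHat_mul_crossUHat_transpose_eq_zero hn i _)) h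
    have k' := (not_imp_comm.1 (crossVHat_mul_crossUHat_transpose_eq_zero hn i _)) h'
    dsimp only at k k'
    have he2 := two_pow_eq hn
    have h3 : ((2 ^ n : ℕ) : ℤ) = (2 : ℤ) ^ n := by push_cast; rfl
    have : a = a' ∧ b = b' := by
      fin_cases q <;> simp only [source] at k k' <;> omega
    obtain ⟨rfl, rfl⟩ := this
    rfl

/-! ### Straight-line programs -/

section Programs

variable {ι κ : Type}

theorem run_append_singleton (x : ι → ℝ) (code : List (Op ι)) (o : Op ι) :
    run x (code ++ [o]) = run x code ++ [o.eval x (run x code)] := by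
  simp [run]

theorem run_append (x : ι → ℝ) (code ext : List (Op ι)) :
    ∃ r, run x (code ++ ext) = run x code ++ r := by
  induction ext using List.reverseRecOn with
  | nil => exact ⟨[], by simp⟩
  | append_singleton ext o ih =>
    obtain ⟨r, hr⟩ := ih
    rw [← List.append_assoc, run_append_singleton, hr]
    exact ⟨_, List.append_assoc _ _ _⟩

theorem length_run (x : ι → ℝ) (code : List (Op ι)) : (run x code).length = code.length := by
  induction code using List.reverseRecOn with
  | nil => rfl
  | append_singleton code o ih => rw [run_append_singleton]; simp [ih]

/-- The functions of the input that some operand holds after `code` has been run. The operand has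
to keep its value whatever is appended, since a reference past the end of the memory reads `0`
only until that place is filled. -/
def available (code : List (Op ι)) : Set ((ι → ℝ) → ℝ) :=
  {f | ∃ a : ι ⊕ ℕ, ∀ ext x, operand x (run x (code ++ ext)) a = f x}

theorem available_append (code ext : List (Op ι)) : available code ⊆ available (code ++ ext) := by
  rintro f ⟨a, ha⟩
  exact ⟨a, fun ext' x => by rw [List.append_assoc]; exact ha _ x⟩

theorem mem_available_append_singleton (code : List (Op ι)) (o : Op ι) (f : (ι → ℝ) → ℝ)
    (h : ∀ x, o.eval x (run x code) = f x) : f ∈ available (code ++ [o]) := by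
  refine ⟨Sum.inr code.length, fun ext x => ?_⟩
  obtain ⟨r, hr⟩ := run_append x (code ++ [o]) ext
  rw [hr, run_append_singleton, ← h]
  simp only [operand, ← length_run x code]
  simp [List.getD]

/-- From the functions in `A`, all functions in `B` can be computed with at most `c` further
operations. -/
def Derivable (A B : Set ((ι → ℝ) → ℝ)) (c : ℕ) : Prop :=
  ∀ code : List (Op ι), A ⊆ available code →
    ∃ ext : List (Op ι), ext.length ≤ c ∧ B ⊆ available (code ++ ext)

variable {A A' B B' C : Set ((ι → ℝ) → ℝ)} {c d : ℕ} {f g : (ι → ℝ) → ℝ}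

theorem Derivable.mono (h : Derivable A B c) (hA : A ⊆ A') (hB : B' ⊆ B) (hc : c ≤ d) :
    Derivable A' B' d := by
  intro code hcode
  obtain ⟨ext, h1, h2⟩ := h code (hA.trans hcode)
  exact ⟨ext, h1.trans hc, hB.trans h2⟩

theorem Derivable.of_subset (h : B ⊆ A) : Derivable A B 0 :=
  fun code hcode => ⟨[], le_rfl, by simpa using h.trans hcode⟩

theorem Derivable.trans (h : Derivable A B c) (h' : Derivable (A ∪ B) C d) :
    Derivable A (B ∪ C) (c + d) := by
  intro code hcode
  obtain ⟨ext, h1, h2⟩ := h code hcode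
  obtain ⟨ext', h3, h4⟩ := h' (code ++ ext)
    (Set.union_subset (hcode.trans (available_append _ _)) h2)
  refine ⟨ext ++ ext', by simp; omega, ?_⟩
  rw [← List.append_assoc]
  exact Set.union_subset (h2.trans (available_append _ _)) h4

theorem Derivable.union (h : Derivable A B c) (h' : Derivable A C d) :
    Derivable A (B ∪ C) (c + d) :=
  h.trans (h'.mono Set.subset_union_left le_rfl le_rfl)

theorem Derivable.iUnion {I : Type} [Fintype I] {B : I → Set ((ι → ℝ) → ℝ)}
    (h : ∀ i, Derivable A (B i) c) : Derivable A (⋃ i, B i) (Fintype.card I * c) := by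
  classical
  have : ∀ s : Finset I, Derivable A (⋃ i ∈ s, B i) (s.card * c) := by
    intro s
    induction s using Finset.induction_on with
    | empty => simpa using Derivable.of_subset (Set.empty_subset A)
    | insert i s hi ih =>
      rw [Finset.card_insert_of_notMem hi, Finset.set_biUnion_insert, add_mul, one_mul, add_comm]
      exact (h i).union ih
  simpa using this Finset.univ

theorem derivable_const (A : Set ((ι → ℝ) → ℝ)) (r : ℝ) :
    Derivable A {fun _ => r} 1 := by
  intro code _
  refine ⟨[Op.const r], le_rfl, Set.singleton_subset_iff.2 ?_⟩
  exact mem_available_append_singleton _ _ _ fun x => rfl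

theorem operand_eq {code : List (Op ι)} {a : ι ⊕ ℕ}
    (h : ∀ ext x, operand x (run x (code ++ ext)) a = f x) (x : ι → ℝ) :
    operand x (run x code) a = f x := by
  simpa using h [] x

theorem derivable_add (hf : f ∈ A) (hg : g ∈ A) : Derivable A {fun x => f x + g x} 1 := by
  intro code hcode
  obtain ⟨a, ha⟩ := hcode hf
  obtain ⟨b, hb⟩ := hcode hg
  refine ⟨[Op.add a b], le_rfl, Set.singleton_subset_iff.2 ?_⟩
  exact mem_available_append_singleton _ _ _ fun x => by
    rw [Op.eval, operand_eq ha, operand_eq hb]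

theorem derivable_sub (hf : f ∈ A) (hg : g ∈ A) : Derivable A {fun x => f x - g x} 1 := by
  intro code hcode
  obtain ⟨a, ha⟩ := hcode hf
  obtain ⟨b, hb⟩ := hcode hg
  refine ⟨[Op.sub a b], le_rfl, Set.singleton_subset_iff.2 ?_⟩
  exact mem_available_append_singleton _ _ _ fun x => by
    rw [Op.eval, operand_eq ha, operand_eq hb]

theorem derivable_mul (hf : f ∈ A) (hg : g ∈ A) : Derivable A {fun x => f x * g x} 1 := by
  intro code hcode
  obtain ⟨a, ha⟩ := hcode hf
  obtain ⟨b, hb⟩ := hcode hg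
  refine ⟨[Op.mul a b], le_rfl, Set.singleton_subset_iff.2 ?_⟩
  exact mem_available_append_singleton _ _ _ fun x => by
    rw [Op.eval, operand_eq ha, operand_eq hb]

/-- A combination of two functions derivable at costs `c`, `d` by one operation. -/
theorem Derivable.add (hf : Derivable A {f} c) (hg : Derivable A {g} d) :
    Derivable A {fun x => f x + g x} (c + d + 1) :=
  ((hf.union hg).trans (derivable_add (f := f) (g := g) (by simp) (by simp))).mono
    le_rfl Set.subset_union_right le_rfl

theorem Derivable.sub (hf : Derivable A {f} c) (hg : Derivable A {g} d) :
    Derivable A {fun x => f x - g x} (c + d + 1) :=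
  ((hf.union hg).trans (derivable_sub (f := f) (g := g) (by simp) (by simp))).mono
    le_rfl Set.subset_union_right le_rfl

theorem Derivable.const_mul (hf : Derivable A {f} c) (r : ℝ) :
    Derivable A {fun x => r * f x} (c + 2) :=
  (((derivable_const A r).union hf).trans
    (derivable_mul (f := fun _ => r) (g := f) (by simp) (by simp))).mono
    le_rfl Set.subset_union_right (by omega)

theorem derivable_of_mem (hf : f ∈ A) : Derivable A {f} 0 :=
  Derivable.of_subset (Set.singleton_subset_iff.2 hf)

theorem derivable_sum {J : Type} (s : Finset J) (r : J → ℝ) (F : J → (ι → ℝ) → ℝ)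
    (hF : ∀ j ∈ s, F j ∈ A) : Derivable A {fun x => ∑ j ∈ s, r j * F j x} (3 * s.card + 1) := by
  classical
  induction s using Finset.induction_on with
  | empty => simpa using derivable_const A 0
  | insert j s hj ih =>
    simp only [Finset.sum_insert hj]
    refine (((derivable_of_mem (hF j (by simp))).const_mul (r j)).add
      (ih fun i hi => hF i (Finset.mem_insert_of_mem hi))).mono le_rfl le_rfl ?_
    rw [Finset.card_insert_of_notMem hj]
    omega

/-- A sequence each of whose terms is derivable from its predecessor. -/
theorem derivable_sequence (F : ℕ → (ι → ℝ) → ℝ) (r : ℕ) (h0 : Derivable A {F 0} c)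
    (h1 : ∀ i < r, Derivable (A ∪ {F i}) {F (i + 1)} d) :
    Derivable A {f | ∃ i ≤ r, F i = f} (c + r * d) := by
  induction r with
  | zero => exact h0.mono le_rfl (by rintro f ⟨i, hi, rfl⟩; simp at hi; simp [hi]) (by omega)
  | succ r ih =>
    refine ((ih fun i hi => h1 i (by omega)).trans ((h1 r (by omega)).mono (A' := A ∪ _)
      (Set.union_subset_union_right A ?_) le_rfl le_rfl)).mono le_rfl ?_ (by rw [add_mul]; omega)
    · exact Set.singleton_subset_iff.2 ⟨r, le_rfl, rfl⟩
    · rintro f ⟨i, hi, rfl⟩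
      rcases Nat.lt_succ_iff_lt_or_eq.1 (Nat.lt_succ_of_le hi) with h | rfl
      · exact Or.inl ⟨i, by omega, rfl⟩
      · exact Or.inr rfl

theorem Derivable.computableIn {F : (ι → ℝ) → κ → ℝ} {T : ℝ}
    (h : Derivable (Set.range fun (i : ι) (x : ι → ℝ) => x i)
      (Set.range fun (k : κ) (x : ι → ℝ) => F x k) c) (hT : (c : ℝ) ≤ T) : ComputableIn F T := by
  obtain ⟨code, h1, h2⟩ := h [] (by rintro _ ⟨i, rfl⟩; exact ⟨Sum.inl i, fun _ _ => rfl⟩)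
  have h3 : ∀ k, ∃ a : ι ⊕ ℕ, ∀ x, operand x (run x code) a = F x k := by
    intro k
    obtain ⟨a, ha⟩ := h2 ⟨k, rfl⟩
    exact ⟨a, fun x => by simpa using ha [] x⟩
  choose out hout using h3
  exact ⟨code, out, le_trans (by exact_mod_cast h1) hT, fun x k => hout k x⟩

end Programs

/-! ### The left inverse property -/

/-- The adjacent factors cancel in pairs, from the middle of the product outwards. -/
theorem spife_mul_transform {n : ℕ} : ∀ {m : ℕ}, 1 ≤ m → m ≤ n →
    spife n m * transform n m = 1
  | 0, h, _ => absurd h (by omega)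
  | 1, _, h => crossVHat_mul_crossUHat_transpose_mul_crossLevel h
  | m + 2, _, h => by
    have ih := spife_mul_transform (n := n) (m := m + 1) (by omega) (by omega)
    rw [spife, transform, levelV_mul_inv_mul_levelU, fullLevel, Matrix.mul_assoc,
      ← Matrix.mul_assoc (_ ⊗ₖ _), ← Matrix.mul_kronecker_mul, Matrix.one_mul,
      levelPinv_mul_level (by omega), Matrix.one_kronecker_one, Matrix.one_mul, ih]

/-! ### Operation counts -/

section Cost

variable {ι : Type} {A : Set ((ι → ℝ) → ℝ)}

/-- A matrix with few nonzero entries in each row is applied at a cost proportional to the number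
of its rows. -/
theorem derivable_sparse_mulVec {R K : Type} [Fintype R] [Fintype K] (M : Matrix R K ℝ) (c : ℕ)
    (hM : ∀ r, (Finset.univ.filter fun k => M r k ≠ 0).card ≤ c) (y : (ι → ℝ) → K → ℝ)
    (hy : ∀ k, (fun x => y x k) ∈ A) :
    Derivable A (Set.range fun r x => (M *ᵥ y x) r) (Fintype.card R * (3 * c + 1)) := by
  refine (Derivable.iUnion (B := fun r => {fun x => (M *ᵥ y x) r}) fun r => ?_).mono le_rfl ?_ le_rfl
  · have h : (fun x => (M *ᵥ y x) r) =
        fun x => ∑ k ∈ Finset.univ.filter (fun k => M r k ≠ 0), M r k * y x k := by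
      ext x
      rw [Matrix.mulVec, dotProduct, Finset.sum_filter_of_ne]
      exact fun k _ h => left_ne_zero_of_mul h
    rw [h]
    exact (derivable_sum _ (fun k => M r k) (fun k x => y x k) fun k _ => hy k).mono le_rfl le_rfl
      (by have := hM r; omega)
  · rintro _ ⟨r, rfl⟩
    exact Set.mem_iUnion.2 ⟨r, rfl⟩

theorem derivable_altMean (t : ℕ) (z : (ι → ℝ) → ℕ → ℝ)
    (hz : ∀ i < t + 1, (fun x => z x i) ∈ A) :
    Derivable A {fun x => altMean t (z x)} (3 * t + 6) := by
  refine ((derivable_sum (Finset.range (t + 1)) (fun i => (-1 : ℝ) ^ i) (fun i x => z x i)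
    fun i hi => hz i (Finset.mem_range.1 hi)).const_mul (1 / ((t : ℝ) + 1))).mono le_rfl le_rfl ?_
  rw [Finset.card_range]
  omega

theorem derivable_deconv (t : ℕ) (z : (ι → ℝ) → ℕ → ℝ)
    (hz : ∀ i < t + 1, (fun x => z x i) ∈ A) :
    Derivable A {f | ∃ i ≤ t, (fun x => deconv t (z x) i) = f} (7 * t + 7) := by
  refine ((derivable_altMean t z hz).trans
    (derivable_sequence (c := 1) (d := 4) (fun i x => deconv t (z x) i) t ?_ ?_)).mono le_rfl
    Set.subset_union_right (by omega)
  · exact (derivable_of_mem (Or.inl (hz 0 (by omega)))).sub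
      (derivable_of_mem (f := fun x => altMean t (z x)) (Or.inr rfl))
  · intro i hi
    exact ((derivable_of_mem (Or.inl (Or.inl (hz (i + 1) (by omega))))).sub
      ((derivable_of_mem (f := fun x => altMean t (z x)) (Or.inl (Or.inr rfl))).const_mul
        ((-1) ^ (i + 1)))).sub (derivable_of_mem (Or.inr rfl))

theorem derivable_doubling (s : ℕ) (z : (ι → ℝ) → Fin s × Fin 2 → ℝ)
    (hz : ∀ a, (fun x => z x a) ∈ A) :
    Derivable A (Set.range fun a x => (((√2)⁻¹ • (doubling s)ᵀ) *ᵥ z x) a) (7 * s) := by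
  have h := derivable_sparse_mulVec ((√2)⁻¹ • (doubling s)ᵀ) 2 (fun a => ?_) z hz
  · rw [Fintype.card_fin, mul_comm] at h
    exact h
  · refine (Finset.card_le_card (t := {a} ×ˢ Finset.univ) ?_).trans (by simp)
    rintro ⟨b, d⟩ hb
    by_cases hab : b = a
    · simp [hab]
    · simp [doubling, hab] at hb

theorem derivable_blockPinv (n s : ℕ) (z : (ι → ℝ) → BlockRow n s → ℝ)
    (hz : ∀ y, (fun x => z x y) ∈ A) :
    Derivable A (Set.range fun k x => (blockPinv n s *ᵥ z x) k) (14 * 2 ^ n + 14 * s + 7) := by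
  let w : (ι → ℝ) → ℕ → ℝ := fun x i =>
    if h : i < 2 * 2 ^ n + 1 then z x (Sum.inr (Sum.inl ⟨i, h⟩)) else 0
  have hw : ∀ x, (fun i : Fin (2 * 2 ^ n + 1) => w x i) = fun i => z x (Sum.inr (Sum.inl i)) := by
    intro x
    ext i
    exact dif_pos i.2
  refine (((derivable_doubling s (fun x a => z x (Sum.inl a)) fun a => hz _).union
    (derivable_deconv (2 * 2 ^ n) w fun i hi => ?_)).union
    (derivable_doubling s (fun x a => z x (Sum.inr (Sum.inr a))) fun a => hz _)).mono
    le_rfl ?_ (by omega)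
  · simpa only [w, dif_pos hi] using hz (Sum.inr (Sum.inl ⟨i, hi⟩))
  · rintro _ ⟨k, rfl⟩
    simp only [blockPinv, Matrix.fromBlocks_mulVec, Matrix.zero_mulVec, add_zero, zero_add]
    rcases k with a | k | a
    · exact Or.inl (Or.inl ⟨a, rfl⟩)
    · refine Or.inl (Or.inr ⟨k, k.2.le, ?_⟩)
      ext x
      rw [← convPinv_mulVec, hw]
      rfl
    · exact Or.inr ⟨a, rfl⟩

/-- The inverse of a level is applied in `O(N²)` operations. -/
theorem derivable_levelPinv {n j : ℕ} (hj : j + 1 ≤ n)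
    (y : (ι → ℝ) → Fin 4 × E n (j + 1) → ℝ) (hy : ∀ r, (fun x => y x r) ∈ A) :
    Derivable A (Set.range fun r x =>
      (((1 : Matrix (Fin 4) (Fin 4) ℝ) ⊗ₖ levelPinv n j) *ᵥ y x) r) (49 * (2 ^ n * 2 ^ n)) := by
  have hE : 2 ^ n = 2 * (2 ^ (n - (j + 1)) * 2 ^ j) := by
    rw [← pow_add, ← pow_succ']; congr 1; omega
  have hone : 1 ≤ 2 ^ (n - (j + 1)) := Nat.one_le_two_pow
  have hcol : ∀ s : Fin (2 ^ j), 2 * (s : ℕ) + 2 ≤ 2 ^ n := by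
    intro s
    have := s.2
    have : 2 ^ j ≤ 2 ^ (n - (j + 1)) * 2 ^ j := Nat.le_mul_of_pos_left _ hone
    omega
  refine (Derivable.iUnion (c := 24 * 2 ^ n)
    (B := fun p : Fin 4 × Fin (2 ^ (n - (j + 1))) × Fin (2 ^ j) =>
      Set.range fun k x => (blockPinv n p.2.2 *ᵥ fun r => y x (p.1,
        ⟨rowCell n j p.2.1 p.2.2 r, rowCell_mem hj ⟨p.2.1, p.2.2, r⟩⟩)) k)
    fun p => ?_).mono le_rfl ?_ ?_
  · refine (derivable_blockPinv n p.2.2 _ fun r => hy _).mono le_rfl le_rfl ?_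
    have := hcol p.2.2
    omega
  · rintro _ ⟨⟨q, e⟩, rfl⟩
    obtain ⟨⟨l, s, k⟩, hx⟩ := colCell_surjective hj e
    refine Set.mem_iUnion.2 ⟨(q, l, s), k, ?_⟩
    ext x
    have h : (((1 : Matrix (Fin 4) (Fin 4) ℝ) ⊗ₖ levelPinv n j) *ᵥ y x) (q, e) =
        (levelPinv n j *ᵥ fun e' => y x (q, e')) e := by
      simp only [Matrix.mulVec, dotProduct]
      rw [Fintype.sum_prod_type, Finset.sum_eq_single q]
      · simp [Matrix.kroneckerMap_apply]
      · intro q' _ hq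
        refine Finset.sum_eq_zero fun e' _ => ?_
        rw [Matrix.kroneckerMap_apply, Matrix.one_apply_ne (Ne.symm hq), zero_mul, zero_mul]
      · simp
    exact ((levelPinv_mulVec_apply hj _ hx).symm.trans h.symm)
  · simp only [Fintype.card_prod, Fintype.card_fin]
    have h4 : 4 * (2 ^ (n - (j + 1)) * 2 ^ j) = 2 * 2 ^ n := by omega
    rw [h4]
    nlinarith [Nat.zero_le (2 ^ n * 2 ^ n)]

/-- Each of the `m` factors is applied in `O(N²)` operations. -/
theorem derivable_spife {n : ℕ} : ∀ {m : ℕ}, 1 ≤ m → m ≤ n →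
    ∀ (A : Set ((ι → ℝ) → ℝ)) (y : (ι → ℝ) → Fin 4 × E n m → ℝ), (∀ r, (fun x => y x r) ∈ A) →
    Derivable A (Set.range fun i x => (spife n m *ᵥ y x) i) (m * (49 * (2 ^ n * 2 ^ n)))
  | 0, h, _ => absurd h (by omega)
  | 1, _, h => fun A y hy => by
    refine (derivable_sparse_mulVec (crossVHat n * (crossUHat n)ᵀ) 16
      (card_support_crossVHat_mul_crossUHat_transpose h) y hy).mono le_rfl le_rfl ?_
    simp only [Fintype.card_prod, Fintype.card_fin]
    omega
  | m + 2, _, h => fun A y hy => by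
    have hlevel := derivable_levelPinv (j := m + 1) (by omega) y hy
    have ih := derivable_spife (n := n) (m := m + 1) (by omega) (by omega)
      (A ∪ Set.range fun r x =>
        (((1 : Matrix (Fin 4) (Fin 4) ℝ) ⊗ₖ levelPinv n (m + 1)) *ᵥ y x) r)
      (fun x => ((1 : Matrix (Fin 4) (Fin 4) ℝ) ⊗ₖ levelPinv n (m + 1)) *ᵥ y x)
      fun r => Or.inr ⟨r, rfl⟩
    refine (hlevel.trans ih).mono le_rfl ?_ (le_of_eq (by ring))
    rintro _ ⟨i, rfl⟩
    refine Or.inr ⟨i, ?_⟩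
    ext x
    rw [spife, levelV_mul_inv_mul_levelU]
    exact congrFun (Matrix.mulVec_mulVec _ _ _) i

end Cost

end ADRT

theorem theorem5p2 :
    (∀ n : ℕ, 1 ≤ n →
      ADRT.spife n n * ADRT.transform n n = 1 ∧
      ADRT.transform n n * ADRT.spife n n * ADRT.transform n n = ADRT.transform n n ∧
      ADRT.spife n n * ADRT.transform n n * ADRT.spife n n = ADRT.spife n n ∧
      ∀ b ∈ Set.range (fun x => ADRT.transform n n *ᵥ x),
        ADRT.transform n n *ᵥ (ADRT.spife n n *ᵥ b) = b ∧
        ∀ x, ADRT.transform n n *ᵥ x = b → x = ADRT.spife n n *ᵥ b) ∧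
    (∃ C : ℝ, ∀ n : ℕ, 1 ≤ n →
      ADRT.ComputableIn (fun b => ADRT.spife n n *ᵥ b)
        (C * ((2 : ℝ) ^ n) ^ 2 * Real.log ((2 : ℝ) ^ n) ^ 2)) := by
  refine ⟨fun n hn => ?_, 200, fun n hn => ?_⟩
  · have h := ADRT.spife_mul_transform hn le_rfl
    refine ⟨h, ?_, ?_, ?_⟩
    · rw [Matrix.mul_assoc, h, Matrix.mul_one]
    · rw [h, Matrix.one_mul]
    · rintro _ ⟨x, rfl⟩
      have hx : ∀ x, ADRT.spife n n *ᵥ (ADRT.transform n n *ᵥ x) = x := fun x => by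
        rw [Matrix.mulVec_mulVec, h, Matrix.one_mulVec]
      refine ⟨by dsimp only; rw [hx], fun x' hx' => ?_⟩
      rw [← hx', hx]
  · refine (ADRT.derivable_spife hn le_rfl (Set.range fun r (b : Fin 4 × ADRT.E n n → ℝ) => b r)
      (fun b => b) fun r => ⟨r, rfl⟩).computableIn ?_
    have hlog : 1 / 4 ≤ Real.log 2 ^ 2 := by nlinarith [Real.log_two_gt_d9]
    have hn1 : (1 : ℝ) ≤ n := by exact_mod_cast hn
    -- One of the two logarithmic factors is not needed; it is bounded below, since `N ≥ 2`.
    have hnn : (n : ℝ) * (1 / 4) ≤ (n * Real.log 2) ^ 2 := by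
      rw [mul_pow]
      exact mul_le_mul (by nlinarith) hlog (by norm_num) (by positivity)
    have hN : (0 : ℝ) ≤ ((2 : ℝ) ^ n) ^ 2 := by positivity
    rw [Real.log_pow]
    push_cast
    nlinarith [mul_le_mul_of_nonneg_left hnn hN]
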